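/- Let $v_{4,0},v_{2,2},v_{0,4},v_{6,0},v_{4,2},v_{2,4},v_{0,6}\in\mathbb R$ and put $A=\frac38(v_{4,0}+v_{0,4})$, $B=\frac34(v_{4,0}-v_{0,4})$, $C=\frac18 v_{2,2}$. Consider the detuned $2{:}2$ Birkhoff normal form $K=K_0+K_2+K_4$, where, with $w=J_1J_2\cos(2\phi_1-2\phi_2)$, $$K_0=J_1+J_2,\qquad K_2=\delta J_1+\tfrac32v_{4,0}J_1^2+\tfrac32v_{0,4}J_2^2+\tfrac12v_{2,2}(2J_1J_2+w),$$ $$K_4=-\delta\big[3v_{4,0}J_1^2+\tfrac12v_{2,2}(2J_1J_2+w)\big]+\tfrac14(10v_{6,0}-17v_{4,0}^2)J_1^3+\tfrac14(10v_{0,6}-17v_{0,4}^2)J_2^3$$ $$+\tfrac14J_1\big[(6v_{4,2}-\tfrac94v_{2,2}^2-12v_{2,2}v_{4,0})J_1J_2+(4v_{4,2}-2v_{2,2}^2-5v_{2,2}v_{4,0})w\big]$$ $$+\tfrac14J_2\big[(6v_{2,4}-\tfrac94v_{2,2}^2-12v_{2,2}v_{0,4})J_1J_2+(4v_{2,4}-2v_{2,2}^2-5v_{2,2}v_{0,4})w\big].$$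 Since $\mathcal E=J_1+J_2$ is conserved, setting $J_1=J$, $J_2=\mathcal E-J$, $\psi=\phi_1-\phi_2$ gives a one-degree-of-freedom Hamiltonian system in the canonical variables $(J,\psi)$, $0\le J\le\mathcal E$, depending on $\mathcal E>0$ and on the detuning $\delta$. Its normal mode $1$ is $J_1=0$ and its normal mode $2$ is $J_2=0$; they are the origins of the coordinates $\sqrt{2J}(\cos\psi,\sin\psi)$ and $\sqrt{2(\mathcal E-J)}(\cos\psi,\sin\psi)$, respectively, in which the system is regular there. All other fixed points have $0<J<\mathcal E$; they are called inclined if $\psi\in\{0,\pi\}$ and loop if $\psi=\pm\pi/2$. A fixed point is called stable if it is elliptic and unstable if it is hyperbolic. Let $$\mathcal E_{1I}=\tfrac{\delta}{2(2A-B-6C)}+\tfrac{136A^2+34B^2+280BC+456C^2-8A(17B+70C)+15v_{2,4}-45v_{0,6}}{48(2A-B-6C)^3}\delta^2,$$ $$\mathcal E_{1L}=\tfrac{\delta}{2(2A-B-2C)}+\tfrac{136A^2+34B^2+104BC+72C^2-8A(17B+26C)+3v_{2,4}-45v_{0,6}}{48(2A-B-2C)^3}\delta^2,$$ $$\mathcal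 E_{2I}=-\tfrac{\delta}{2(2A+B-6C)}-\tfrac{56A^2+14B^2+8A(7B-74C)-296BC+1272C^2+45v_{6,0}-15v_{4,2}}{48(2A+B-6C)^3}\delta^2,$$ $$\mathcal E_{2L}=-\tfrac{\delta}{2(2A+B-2C)}-\tfrac{56A^2+14B^2+8A(7B-22C)-88BC+120C^2+45v_{6,0}-3v_{4,2}}{48(2A+B-2C)^3}\delta^2.$$ Assume $C\ne0$, $A-3C>0$, $A-C>0$ and the conditions under which these thresholds are positive for small $\delta<0$, namely $B>2(A-3C)$, $B>2(A-C)$, $B>2(3C-A)$ and $B>2(C-A)$. Then there are thresholds $e_{1I},e_{1L},e_{2I},e_{2L}$, functions of $\delta$, with $e_{kK}(\delta)=\mathcal E_{kK}(\delta)+O(\delta^3)$ as $\delta\to0^-$, and there are $\delta_0,\varepsilon>0$ such that for all $\delta\in(-\delta_0,0)$ the following is the full bifurcation sequence as $\mathcal E$ increases through $(0,\varepsilon)$. If $C>0$, it is $(2L)-(2i)-(1i)-(1L)$: $0<e_{2L}<e_{2I}<e_{1I}<e_{1L}<\varepsilon$; at $e_{2L}$ a pair of stable loop fixed points appears from mode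 $2$ in a pitchfork bifurcation; at $e_{2I}$ a pair of unstable inclined fixed points appears from mode $2$ in a pitchfork bifurcation; at $e_{1I}$ the unstable inclined pair disappears in mode $1$ in an anti-pitchfork bifurcation; at $e_{1L}$ the stable loop pair disappears in mode $1$ in an anti-pitchfork bifurcation. If $C<0$, it is $(2I)-(2\ell)-(1\ell)-(1I)$: $0<e_{2I}<e_{2L}<e_{1L}<e_{1I}<\varepsilon$, and the same holds with inclined and loop exchanged (the inclined pair is stable, appearing at $e_{2I}$ and disappearing at $e_{1I}$; the loop pair is unstable, appearing at $e_{2L}$ and disappearing at $e_{1L}$). At each of these bifurcations the normal mode involved changes its stability: while the pair exists near the mode, the mode has the type opposite to that of the pair, and on the other side of the threshold it has the same type as the pair. There is no other bifurcation: for every $\mathcal E\in(0,\varepsilon)$ the fixed points are exactly the two normal modes and the pairs that exist at that $\mathcal E$ (each for $\mathcal E$ strictly between its two thresholds), the pairs keep their type, and each normal mode is stable except strictly between its own two thresholds, where it is unstable. -/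

import Mathlib

open Set Filter Topology Asymptotics

noncomputable section

/-- Coefficients of the quartic and sextic terms of the potential
`v₄₀ x₁⁴ + v₂₂ x₁² x₂² + v₀₄ x₂⁴ + v₆₀ x₁⁶ + v₄₂ x₁⁴ x₂² + v₂₄ x₁² x₂⁴ + v₀₆ x₂⁶`. -/
structure ResCoeffs where
  v40 : ℝ
  v22 : ℝ
  v04 : ℝ
  v60 : ℝ
  v42 : ℝ
  v24 : ℝ
  v06 : ℝ

namespace ResCoeffs

/-- `A = (3/8)(v₄₀ + v₀₄)`. -/
def A (p : ResCoeffs) : ℝ := 3 / 8 * (p.v40 + p.v04)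

/-- `B = (3/4)(v₄₀ - v₀₄)`. -/
def B (p : ResCoeffs) : ℝ := 3 / 4 * (p.v40 - p.v04)

/-- `C = v₂₂ / 8`. -/
def C (p : ResCoeffs) : ℝ := 1 / 8 * p.v22

/-- The detuned 2:2 Birkhoff normal form `K₀ + K₂ + K₄`. The phases occur in it only through
the product `J₁ J₂ cos (2φ₁ - 2φ₂)`, which is the argument `w`. -/
def normalForm (p : ResCoeffs) (δ J₁ J₂ w : ℝ) : ℝ :=
  (J₁ + J₂)
  + (δ * J₁ + 3 / 2 * p.v40 * J₁ ^ 2 + 3 / 2 * p.v04 * J₂ ^ 2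
      + 1 / 2 * p.v22 * (2 * (J₁ * J₂) + w))
  + (-δ * (3 * p.v40 * J₁ ^ 2 + 1 / 2 * p.v22 * (2 * (J₁ * J₂) + w))
      + 1 / 4 * (10 * p.v60 - 17 * p.v40 ^ 2) * J₁ ^ 3
      + 1 / 4 * (10 * p.v06 - 17 * p.v04 ^ 2) * J₂ ^ 3
      + 1 / 4 * J₁ * ((6 * p.v42 - 9 / 4 * p.v22 ^ 2 - 12 * p.v22 * p.v40) * (J₁ * J₂)
          + (4 * p.v42 - 2 * p.v22 ^ 2 - 5 * p.v22 * p.v40) * w)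
      + 1 / 4 * J₂ * ((6 * p.v24 - 9 / 4 * p.v22 ^ 2 - 12 * p.v22 * p.v04) * (J₁ * J₂)
          + (4 * p.v24 - 2 * p.v22 ^ 2 - 5 * p.v22 * p.v04) * w))

/-- The Hamiltonian of the one-degree-of-freedom system: the normal form with `J₁ = J`,
`J₂ = E - J`, `ψ = φ₁ - φ₂`, as a function of `z = (J, ψ)`, where `0 ≤ J ≤ E`. -/
def K (p : ResCoeffs) (δ E : ℝ) (z : ℝ × ℝ) : ℝ :=
  p.normalForm δ z.1 (E - z.1) (z.1 * (E - z.1) * Real.cos (2 * z.2))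

/-- The Hamiltonian in the Cartesian coordinates `x = √(2J) cos ψ`, `y = √(2J) sin ψ`, which
are regular at the normal mode `J₁ = J = 0`. -/
def planarK₁ (p : ResCoeffs) (δ E : ℝ) (z : ℝ × ℝ) : ℝ :=
  p.normalForm δ ((z.1 ^ 2 + z.2 ^ 2) / 2) (E - (z.1 ^ 2 + z.2 ^ 2) / 2)
    ((E - (z.1 ^ 2 + z.2 ^ 2) / 2) * ((z.1 ^ 2 - z.2 ^ 2) / 2))

/-- The Hamiltonian in the Cartesian coordinates `x' = √(2(E - J)) cos ψ`,
`y' = √(2(E - J)) sin ψ`, which are regular at the normal mode `J₂ = E - J = 0`. -/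
def planarK₂ (p : ResCoeffs) (δ E : ℝ) (z : ℝ × ℝ) : ℝ :=
  p.normalForm δ (E - (z.1 ^ 2 + z.2 ^ 2) / 2) ((z.1 ^ 2 + z.2 ^ 2) / 2)
    ((E - (z.1 ^ 2 + z.2 ^ 2) / 2) * ((z.1 ^ 2 - z.2 ^ 2) / 2))

/-- The Hamiltonian written as `E + 𝒜₁ + ℬ₁ cos 2ψ + 𝒜₂ + ℬ₂ cos 2ψ`. -/
theorem K_eq (p : ResCoeffs) (δ E J ψ : ℝ) :
    p.K δ E (J, ψ) = E
      + ((2 * p.A - p.B) * E ^ 2 + (-4 * p.A + 2 * p.B + 8 * p.C) * E * J + δ * J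
          + 4 * (p.A - 2 * p.C) * J ^ 2)
      + 4 * p.C * J * (E - J) * Real.cos (2 * ψ)
      + (1 / 9 * (68 * p.A * p.B - 68 * p.A ^ 2 - 17 * p.B ^ 2 + 45 / 2 * p.v06) * E ^ 3
          - 8 * p.C * δ * E * J
          + (68 / 3 * p.A ^ 2 - 68 / 3 * p.A * p.B + 17 / 3 * p.B ^ 2 - 32 * p.A * p.C
              + 16 * p.B * p.C - 36 * p.C ^ 2 + 3 / 2 * p.v24 - 15 / 2 * p.v06) * E ^ 2 * J
          + (68 / 3 * p.A * p.B - 68 / 3 * p.A ^ 2 - 17 / 3 * p.B ^ 2 + 32 * p.A * p.C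
              - 48 * p.B * p.C + 36 * p.C ^ 2 + 3 / 2 * p.v42 - 3 * p.v24
              + 15 / 2 * p.v06) * E * J ^ 2
          + 2 * (4 * p.C - 2 * p.A - p.B) * δ * J ^ 2
          + (32 * p.B * p.C + 5 / 2 * p.v60 - 136 / 9 * p.A * p.B - 3 / 2 * p.v42
              + 3 / 2 * p.v24 - 5 / 2 * p.v06) * J ^ 3)
      + (-4 * p.C * δ * E * J
          + (p.v24 - 32 * p.C ^ 2 - 40 / 3 * p.A * p.C + 20 / 3 * p.B * p.C) * E ^ 2 * J
          + (40 / 3 * p.A * p.C - 20 * p.B * p.C + 32 * p.C ^ 2 + p.v42 - 2 * p.v24) * E * J ^ 2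
          + 4 * p.C * δ * J ^ 2
          + (40 / 3 * p.B * p.C - p.v42 + p.v24) * J ^ 3) * Real.cos (2 * ψ) := by
  simp only [K, normalForm, A, B, C]
  ring

theorem planarK₁_polar (p : ResCoeffs) (δ E J ψ : ℝ) (hJ : 0 ≤ J) :
    p.planarK₁ δ E (√(2 * J) * Real.cos ψ, √(2 * J) * Real.sin ψ) = p.K δ E (J, ψ) := by
  have h : √(2 * J) ^ 2 = 2 * J := Real.sq_sqrt (by positivity)
  have hs : Real.sin ψ ^ 2 = 1 - Real.cos ψ ^ 2 := Real.sin_sq ψ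
  have h1 : ((√(2 * J) * Real.cos ψ) ^ 2 + (√(2 * J) * Real.sin ψ) ^ 2) / 2 = J := by
    rw [mul_pow, mul_pow, h, hs]; ring
  have h2 : ((√(2 * J) * Real.cos ψ) ^ 2 - (√(2 * J) * Real.sin ψ) ^ 2) / 2
      = J * Real.cos (2 * ψ) := by
    rw [mul_pow, mul_pow, h, hs, Real.cos_two_mul]; ring
  simp only [planarK₁, K, h1, h2]
  congr 1
  ring

theorem planarK₂_polar (p : ResCoeffs) (δ E J ψ : ℝ) (hJ : J ≤ E) :
    p.planarK₂ δ E (√(2 * (E - J)) * Real.cos ψ, √(2 * (E - J)) * Real.sin ψ)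
      = p.K δ E (J, ψ) := by
  have h : √(2 * (E - J)) ^ 2 = 2 * (E - J) := Real.sq_sqrt (by linarith)
  have hs : Real.sin ψ ^ 2 = 1 - Real.cos ψ ^ 2 := Real.sin_sq ψ
  have h1 : ((√(2 * (E - J)) * Real.cos ψ) ^ 2 + (√(2 * (E - J)) * Real.sin ψ) ^ 2) / 2
      = E - J := by
    rw [mul_pow, mul_pow, h, hs]; ring
  have h2 : ((√(2 * (E - J)) * Real.cos ψ) ^ 2 - (√(2 * (E - J)) * Real.sin ψ) ^ 2) / 2
      = (E - J) * Real.cos (2 * ψ) := by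
    rw [mul_pow, mul_pow, h, hs, Real.cos_two_mul]; ring
  simp only [planarK₂, K, h1, h2, sub_sub_cancel]
  congr 1
  ring

/-- Threshold `E₁I`, up to second order in the detuning. -/
def E1I (p : ResCoeffs) (δ : ℝ) : ℝ :=
  δ / (2 * (2 * p.A - p.B - 6 * p.C))
  + (136 * p.A ^ 2 + 34 * p.B ^ 2 + 280 * p.B * p.C + 456 * p.C ^ 2
      - 8 * p.A * (17 * p.B + 70 * p.C) + 15 * p.v24 - 45 * p.v06) * δ ^ 2
    / (48 * (2 * p.A - p.B - 6 * p.C) ^ 3)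

/-- Threshold `E₁L`, up to second order in the detuning. -/
def E1L (p : ResCoeffs) (δ : ℝ) : ℝ :=
  δ / (2 * (2 * p.A - p.B - 2 * p.C))
  + (136 * p.A ^ 2 + 34 * p.B ^ 2 + 104 * p.B * p.C + 72 * p.C ^ 2
      - 8 * p.A * (17 * p.B + 26 * p.C) + 3 * p.v24 - 45 * p.v06) * δ ^ 2
    / (48 * (2 * p.A - p.B - 2 * p.C) ^ 3)

/-- Threshold `E₂I`, up to second order in the detuning. -/
def E2I (p : ResCoeffs) (δ : ℝ) : ℝ :=
  -(δ / (2 * (2 * p.A + p.B - 6 * p.C)))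
  - (56 * p.A ^ 2 + 14 * p.B ^ 2 + 8 * p.A * (7 * p.B - 74 * p.C) - 296 * p.B * p.C
      + 1272 * p.C ^ 2 + 45 * p.v60 - 15 * p.v42) * δ ^ 2
    / (48 * (2 * p.A + p.B - 6 * p.C) ^ 3)

/-- Threshold `E₂L`, up to second order in the detuning. -/
def E2L (p : ResCoeffs) (δ : ℝ) : ℝ :=
  -(δ / (2 * (2 * p.A + p.B - 2 * p.C)))
  - (56 * p.A ^ 2 + 14 * p.B ^ 2 + 8 * p.A * (7 * p.B - 22 * p.C) - 88 * p.B * p.C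
      + 120 * p.C ^ 2 + 45 * p.v60 - 3 * p.v42) * δ ^ 2
    / (48 * (2 * p.A + p.B - 2 * p.C) ^ 3)

end ResCoeffs

/-- The Hamiltonian vector field of `H` in canonical coordinates `z = (J, ψ)` or `(x, y)`:
`J' = -∂H/∂ψ`, `ψ' = ∂H/∂J`. -/
def hamField (H : ℝ × ℝ → ℝ) (z : ℝ × ℝ) : ℝ × ℝ :=
  (-(fderiv ℝ H z (0, 1)), fderiv ℝ H z (1, 0))

/-- `lam` is an eigenvalue (characteristic exponent) of the linearization of the Hamiltonian
vector field of `H` at `z`. -/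
def IsExponent (H : ℝ × ℝ → ℝ) (z : ℝ × ℝ) (lam : ℂ) : Prop :=
  (((fderiv ℝ (hamField H) z : (ℝ × ℝ) →L[ℝ] (ℝ × ℝ)) :
    (ℝ × ℝ) →ₗ[ℝ] (ℝ × ℝ)).charpoly.map (algebraMap ℝ ℂ)).IsRoot lam

/-- The two types of nondegenerate fixed points of a planar Hamiltonian system. -/
inductive Nature
  | stable
  | unstable

/-- The opposite type. -/
def Nature.opp : Nature → Nature
  | .stable => .unstable
  | .unstable => .stable

/-- `z` is a fixed point of the Hamiltonian system of `H` that is stable, i.e. elliptic (its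
exponents are nonzero and purely imaginary), respectively unstable, i.e. hyperbolic (its
exponents are off the imaginary axis). -/
def HasNature (H : ℝ × ℝ → ℝ) (z : ℝ × ℝ) : Nature → Prop
  | .stable => hamField H z = 0 ∧ ∀ lam : ℂ, IsExponent H z lam → lam ≠ 0 ∧ lam.re = 0
  | .unstable => hamField H z = 0 ∧ ∀ lam : ℂ, IsExponent H z lam → lam.re ≠ 0

/-- The two normal modes: `one` is `J₁ = 0` and `two` is `J₂ = 0`. -/
inductive Mode
  | one
  | two

/-- The value of `J = J₁` on a normal mode. -/
def Mode.J (E : ℝ) : Mode → ℝ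
  | .one => 0
  | .two => E

/-- The type of a normal mode, which is the origin of the planar system that is regular there.
(The second planar chart reverses the orientation, hence time; the types do not change.) -/
def ModeNature (p : ResCoeffs) (δ E : ℝ) : Mode → Nature → Prop
  | .one, s => HasNature (p.planarK₁ δ E) (0, 0) s
  | .two, s => HasNature (p.planarK₂ δ E) (0, 0) s

/-- The two families of periodic orbits in general position. -/
inductive Family
  | inclined
  | loop

/-- The phase differences `ψ` on a family: `0, π` on inclined orbits, `±π/2` on loop orbits. -/
def Family.angles : Family → Set ℝ
  | .inclined => {0, Real.pi}
  | .loop => {Real.pi / 2, -(Real.pi / 2)}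

/-- The fixed points in general position of the one-degree-of-freedom system, i.e. those other
than the normal modes, with the angle `ψ` represented in `(-π, π]`. -/
def fixedPoints (p : ResCoeffs) (δ E : ℝ) : Set (ℝ × ℝ) :=
  {z | 0 < z.1 ∧ z.1 < E ∧ z.2 ∈ Ioc (-Real.pi) Real.pi ∧ hamField (p.K δ E) z = 0}

/-- The fixed points in general position that belong to the family `X`. -/
def familyPoints (p : ResCoeffs) (δ E : ℝ) (X : Family) : Set (ℝ × ℝ) :=
  {z ∈ fixedPoints p δ E | z.2 ∈ X.angles}

/-- The fixed points of the family `X` are a pair, at the common value `J`, and both are of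
type `s`. -/
def IsPair (p : ResCoeffs) (δ E : ℝ) (X : Family) (s : Nature) (J : ℝ) : Prop :=
  familyPoints p δ E X = {J} ×ˢ X.angles ∧ ∀ z ∈ familyPoints p δ E X, HasNature (p.K δ E) z s

/-- A pitchfork at `E = e` between the normal mode `k` and a pair of fixed points of type `s` of
the family `X`. The pair exists for `E` on the side `present` of `e`, where the mode is of the
opposite type, and it does not exist on the side `absent`, where the mode is of type `s`. The
pair converges to the mode as `E → e`. -/
def PitchforkOn (p : ResCoeffs) (δ : ℝ) (k : Mode) (X : Family) (s : Nature) (e : ℝ)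
    (absent present : Filter ℝ) : Prop :=
  (∀ᶠ E in absent, familyPoints p δ E X = ∅ ∧ ModeNature p δ E k s) ∧
  ∃ J : ℝ → ℝ,
    (∀ᶠ E in present, IsPair p δ E X s (J E) ∧ ModeNature p δ E k s.opp) ∧
    Tendsto J present (𝓝 (k.J e))

/-- Pitchfork bifurcation: as `E` increases through `e`, the pair appears from the mode. -/
def Pitchfork (p : ResCoeffs) (δ : ℝ) (k : Mode) (X : Family) (s : Nature) (e : ℝ) : Prop :=
  PitchforkOn p δ k X s e (𝓝[<] e) (𝓝[>] e)

/-- Anti-pitchfork bifurcation: as `E` increases through `e`, the pair disappears in the mode. -/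
def AntiPitchfork (p : ResCoeffs) (δ : ℝ) (k : Mode) (X : Family) (s : Nature) (e : ℝ) : Prop :=
  PitchforkOn p δ k X s e (𝓝[>] e) (𝓝[<] e)

/-- For `0 < E < ε`, the full bifurcation sequence is: at `a` a stable pair of the family `X`
appears from mode 2; at `b` an unstable pair of the family `Y` appears from mode 2; at `c` the
unstable pair of `Y` disappears in mode 1; at `d` the stable pair of `X` disappears in mode 1.
Nothing else happens: the last clauses list all fixed points and their types for all `E`. -/
structure FullSequence (p : ResCoeffs) (δ ε : ℝ) (X Y : Family) (a b c d : ℝ) : Prop where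
  order : 0 < a ∧ a < b ∧ b < c ∧ c < d ∧ d < ε
  bif_a : Pitchfork p δ .two X .stable a
  bif_b : Pitchfork p δ .two Y .unstable b
  bif_c : AntiPitchfork p δ .one Y .unstable c
  bif_d : AntiPitchfork p δ .one X .stable d
  points : ∀ E ∈ Ioo 0 ε,
    fixedPoints p δ E = familyPoints p δ E .inclined ∪ familyPoints p δ E .loop
  points_X : ∀ E ∈ Ioo 0 ε,
    (E ∈ Ioo a d → ∃ J, IsPair p δ E X .stable J) ∧
    (E ∉ Ioo a d → familyPoints p δ E X = ∅)
  points_Y : ∀ E ∈ Ioo 0 ε,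
    (E ∈ Ioo b c → ∃ J, IsPair p δ E Y .unstable J) ∧
    (E ∉ Ioo b c → familyPoints p δ E Y = ∅)
  mode_two : ∀ E ∈ Ioo 0 ε,
    (E < a ∨ b < E → ModeNature p δ E .two .stable) ∧
    (E ∈ Ioo a b → ModeNature p δ E .two .unstable)
  mode_one : ∀ E ∈ Ioo 0 ε,
    (E < c ∨ d < E → ModeNature p δ E .one .stable) ∧
    (E ∈ Ioo c d → ModeNature p δ E .one .unstable)

end

/-!
On the family with `cos 2ψ = σ` (`σ = 1` inclined, `σ = -1` loop) the phase velocity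
`∂K/∂J` is a quadratic polynomial `F_σ` in `J`, whose difference quotients are close to
`8 (A - 2C - σC) > 0` for small energy and detuning. The other component of the field is
a multiple of `J (E - J) (b₀ + b₁ J) sin 2ψ` with `b₀ + b₁ J ≈ 4C ≠ 0`, so all fixed points in
`0 < J < E` are zeros of `F_σ` on one of the two families. As `F_σ` increases, there is such a zero
exactly if `F_σ(0) < 0 < F_σ(E)`, and it is then unique; this gives the pairs
(`IsRegime.exists_familyPoints_eq`, `IsRegime.familyPoints_eq_empty`). The squares of the exponents
on a pair have the sign of `σ C` (`hasNature_K`). At a normal mode the Hessian is diagonal with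
entries `F_1` and `F_{-1}` at that mode, up to a common sign, so the mode is stable if these two
numbers have the same sign and unstable if they have opposite signs (`modeNature_of_freq`).

Everything is therefore decided by the signs of the four numbers `F_σ(0)`, `F_σ(E)`. Each of them is
of the form `δ + l E + m δ E + q E²` with `l > 0` (`freq_mode`), and so changes sign once for small
`E`, at the root that is small with `δ`. This root is the threshold (`smallRoot`); its expansion is
`-δ / l + (m / l² - q / l³) δ² + O(δ³)`, and the order of the thresholds is the reverse order of the
four values of `l`.
-/

/-! ### Linearization of planar Hamiltonian fields -/

/-- If the linearized field exchanges the coordinate axes, with entries `α` and `β`, its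
characteristic exponents are the square roots of `α β`. -/
theorem isExponent_iff_sq {H : ℝ × ℝ → ℝ} {z : ℝ × ℝ} {L : ℝ × ℝ →L[ℝ] ℝ × ℝ} {α β : ℝ}
    (hL : HasFDerivAt (hamField H) L z) (h₁ : L (1, 0) = (0, α)) (h₂ : L (0, 1) = (β, 0))
    (lam : ℂ) : IsExponent H z lam ↔ lam ^ 2 = ((α * β : ℝ) : ℂ) := by
  have hM : LinearMap.toMatrix (Module.Basis.finTwoProd ℝ) (Module.Basis.finTwoProd ℝ)
      (L : ℝ × ℝ →ₗ[ℝ] ℝ × ℝ) = !![0, β; α, 0] := by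
    ext i j
    fin_cases i <;> fin_cases j <;> simp [LinearMap.toMatrix_apply, h₁, h₂]
  rw [IsExponent, hL.fderiv,
    ← LinearMap.charpoly_toMatrix _ (Module.Basis.finTwoProd ℝ), hM, Matrix.charpoly_fin_two]
  simp [Matrix.trace_fin_two, Matrix.det_fin_two, Polynomial.IsRoot, sub_eq_zero, mul_comm,
    ← sub_eq_add_neg]

theorem hasNature_stable {H : ℝ × ℝ → ℝ} {z : ℝ × ℝ} {L : ℝ × ℝ →L[ℝ] ℝ × ℝ} {α β : ℝ}
    (h0 : hamField H z = 0) (hL : HasFDerivAt (hamField H) L z)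
    (h₁ : L (1, 0) = (0, α)) (h₂ : L (0, 1) = (β, 0)) (h : α * β < 0) :
    HasNature H z .stable := by
  refine ⟨h0, fun lam hlam => ?_⟩
  rw [isExponent_iff_sq hL h₁ h₂, sq, Complex.ext_iff] at hlam
  simp only [Complex.mul_re, Complex.mul_im, Complex.ofReal_re, Complex.ofReal_im] at hlam
  obtain ⟨hre, him⟩ := hlam
  have hprod : lam.re * lam.im = 0 := by linarith
  rcases mul_eq_zero.1 hprod with hr | hi
  · refine ⟨fun h' => ?_, hr⟩
    simp [h'] at hre
    rcases hre with hre | hre <;> simp [hre] at h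
  · rw [hi] at hre
    nlinarith [mul_self_nonneg lam.re]

theorem hasNature_unstable {H : ℝ × ℝ → ℝ} {z : ℝ × ℝ} {L : ℝ × ℝ →L[ℝ] ℝ × ℝ} {α β : ℝ}
    (h0 : hamField H z = 0) (hL : HasFDerivAt (hamField H) L z)
    (h₁ : L (1, 0) = (0, α)) (h₂ : L (0, 1) = (β, 0)) (h : 0 < α * β) :
    HasNature H z .unstable := by
  refine ⟨h0, fun lam hlam hr => ?_⟩
  rw [isExponent_iff_sq hL h₁ h₂, sq, Complex.ext_iff] at hlam
  simp only [Complex.mul_re, Complex.mul_im, Complex.ofReal_re, Complex.ofReal_im, hr] at hlam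
  nlinarith [mul_self_nonneg lam.im, hlam.1]

/-- The Hamiltonian field of `a(J) + b(J) cos 2ψ`. -/
theorem hamField_action_angle {H : ℝ × ℝ → ℝ} {a b a' b' : ℝ → ℝ}
    (hH : ∀ z, H z = a z.1 + b z.1 * Real.cos (2 * z.2))
    (ha : ∀ x, HasDerivAt a (a' x) x) (hb : ∀ x, HasDerivAt b (b' x) x) (z : ℝ × ℝ) :
    hamField H z =
      (2 * (b z.1 * Real.sin (2 * z.2)), a' z.1 + b' z.1 * Real.cos (2 * z.2)) := by
  have h1 : HasFDerivAt (fun z : ℝ × ℝ => z.1) (ContinuousLinearMap.fst ℝ ℝ ℝ) z := hasFDerivAt_fst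
  have h2 : HasFDerivAt (fun z : ℝ × ℝ => z.2) (ContinuousLinearMap.snd ℝ ℝ ℝ) z := hasFDerivAt_snd
  have hd := ((ha z.1).comp_hasFDerivAt z h1).add
    (((hb z.1).comp_hasFDerivAt z h1).mul (h2.const_mul 2).cos)
  rw [hamField, (hd.congr_of_eventuallyEq (Eventually.of_forall hH)).fderiv]
  simp
  constructor <;> ring

/-- On the lines `sin 2ψ = 0`, `cos 2ψ = σ`, the linearization at a fixed point has
the entries `∂²H/∂J² = a'' + σ b''` and `-∂²H/∂ψ² = 4 σ b`. -/
theorem hasFDerivAt_hamField_action_angle {H : ℝ × ℝ → ℝ} {a b a' b' : ℝ → ℝ} {a₂ b₂ σ : ℝ}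
    (hH : ∀ z, H z = a z.1 + b z.1 * Real.cos (2 * z.2))
    (ha : ∀ x, HasDerivAt a (a' x) x) (hb : ∀ x, HasDerivAt b (b' x) x) {z : ℝ × ℝ}
    (ha' : HasDerivAt a' a₂ z.1) (hb' : HasDerivAt b' b₂ z.1)
    (hs : Real.sin (2 * z.2) = 0) (hc : Real.cos (2 * z.2) = σ) :
    ∃ L : ℝ × ℝ →L[ℝ] ℝ × ℝ, HasFDerivAt (hamField H) L z ∧
      L (1, 0) = (0, a₂ + σ * b₂) ∧ L (0, 1) = (4 * σ * b z.1, 0) := by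
  have h1 : HasFDerivAt (fun z : ℝ × ℝ => z.1) (ContinuousLinearMap.fst ℝ ℝ ℝ) z := hasFDerivAt_fst
  have h2 : HasFDerivAt (fun z : ℝ × ℝ => z.2) (ContinuousLinearMap.snd ℝ ℝ ℝ) z := hasFDerivAt_snd
  have hd := ((((hb z.1).comp_hasFDerivAt z h1).mul (h2.const_mul 2).sin).const_mul 2).prodMk
    ((ha'.comp_hasFDerivAt z h1).add
      ((hb'.comp_hasFDerivAt z h1).mul (h2.const_mul 2).cos))
  refine ⟨_, hd.congr_of_eventuallyEq
    (Eventually.of_forall fun y => hamField_action_angle hH ha hb y), ?_, ?_⟩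
  · simp [hs, hc]
  · simp [hs, hc]; ring

/-- The Hamiltonian field of a Hamiltonian that depends on `x² + y²` and, linearly, on
`x² - y²`. -/
theorem hamField_planar {H : ℝ × ℝ → ℝ} {a b a' b' : ℝ → ℝ}
    (hH : ∀ z, H z = a ((z.1 ^ 2 + z.2 ^ 2) / 2) +
      b ((z.1 ^ 2 + z.2 ^ 2) / 2) * ((z.1 ^ 2 - z.2 ^ 2) / 2))
    (ha : ∀ x, HasDerivAt a (a' x) x) (hb : ∀ x, HasDerivAt b (b' x) x) (z : ℝ × ℝ) :
    hamField H z =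
      (-(z.2 * (a' ((z.1 ^ 2 + z.2 ^ 2) / 2) +
          b' ((z.1 ^ 2 + z.2 ^ 2) / 2) * ((z.1 ^ 2 - z.2 ^ 2) / 2) -
          b ((z.1 ^ 2 + z.2 ^ 2) / 2))),
        z.1 * (a' ((z.1 ^ 2 + z.2 ^ 2) / 2) +
          b' ((z.1 ^ 2 + z.2 ^ 2) / 2) * ((z.1 ^ 2 - z.2 ^ 2) / 2) +
          b ((z.1 ^ 2 + z.2 ^ 2) / 2))) := by
  have h1 : HasFDerivAt (fun z : ℝ × ℝ => z.1) (ContinuousLinearMap.fst ℝ ℝ ℝ) z := hasFDerivAt_fst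
  have h2 : HasFDerivAt (fun z : ℝ × ℝ => z.2) (ContinuousLinearMap.snd ℝ ℝ ℝ) z := hasFDerivAt_snd
  have hJ : HasFDerivAt (fun z : ℝ × ℝ => (z.1 ^ 2 + z.2 ^ 2) / 2) _ z :=
    ((h1.pow 2).add (h2.pow 2)).mul_const (2⁻¹ : ℝ)
  have hD : HasFDerivAt (fun z : ℝ × ℝ => (z.1 ^ 2 - z.2 ^ 2) / 2) _ z :=
    ((h1.pow 2).sub (h2.pow 2)).mul_const (2⁻¹ : ℝ)
  have hd := ((ha ((z.1 ^ 2 + z.2 ^ 2) / 2)).comp_hasFDerivAt z hJ).add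
    (((hb ((z.1 ^ 2 + z.2 ^ 2) / 2)).comp_hasFDerivAt z hJ).mul hD)
  rw [hamField, (hd.congr_of_eventuallyEq (Eventually.of_forall hH)).fderiv]
  simp
  constructor <;> ring

/-- The origin is a fixed point of such a Hamiltonian, and the Hessian there is diagonal with
entries `a'(0) + b(0)` and `a'(0) - b(0)`; the type is decided by the sign of their product. -/
theorem hasNature_planar_origin {H : ℝ × ℝ → ℝ} {a b a' b' : ℝ → ℝ}
    (hH : ∀ z, H z = a ((z.1 ^ 2 + z.2 ^ 2) / 2) +
      b ((z.1 ^ 2 + z.2 ^ 2) / 2) * ((z.1 ^ 2 - z.2 ^ 2) / 2))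
    (ha : ∀ x, HasDerivAt a (a' x) x) (hb : ∀ x, HasDerivAt b (b' x) x)
    (ha' : Differentiable ℝ a') (hb' : Differentiable ℝ b') :
    (0 < (a' 0 + b 0) * (a' 0 - b 0) → HasNature H (0, 0) .stable) ∧
    ((a' 0 + b 0) * (a' 0 - b 0) < 0 → HasNature H (0, 0) .unstable) := by
  have hF := hamField_planar hH ha hb
  have h0 : hamField H (0, 0) = 0 := by simp [hF]
  have hb0 : Differentiable ℝ b := fun x => (hb x).differentiableAt
  have hP : DifferentiableAt ℝ (fun z : ℝ × ℝ => a' ((z.1 ^ 2 + z.2 ^ 2) / 2) +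
      b' ((z.1 ^ 2 + z.2 ^ 2) / 2) * ((z.1 ^ 2 - z.2 ^ 2) / 2) +
      b ((z.1 ^ 2 + z.2 ^ 2) / 2)) (0, 0) := by fun_prop
  have hQ : DifferentiableAt ℝ (fun z : ℝ × ℝ => a' ((z.1 ^ 2 + z.2 ^ 2) / 2) +
      b' ((z.1 ^ 2 + z.2 ^ 2) / 2) * ((z.1 ^ 2 - z.2 ^ 2) / 2) -
      b ((z.1 ^ 2 + z.2 ^ 2) / 2)) (0, 0) := by fun_prop
  have h1 : HasFDerivAt (fun z : ℝ × ℝ => z.1) (ContinuousLinearMap.fst ℝ ℝ ℝ) (0, 0) :=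
    hasFDerivAt_fst
  have h2 : HasFDerivAt (fun z : ℝ × ℝ => z.2) (ContinuousLinearMap.snd ℝ ℝ ℝ) (0, 0) :=
    hasFDerivAt_snd
  have hd := ((h2.mul hQ.hasFDerivAt).neg.prodMk (h1.mul hP.hasFDerivAt)).congr_of_eventuallyEq
    (Eventually.of_forall hF)
  refine ⟨fun h => hasNature_stable (α := a' 0 + b 0) (β := -(a' 0 - b 0)) h0 hd ?_ ?_
    (by linarith), fun h => hasNature_unstable (α := a' 0 + b 0) (β := -(a' 0 - b 0)) h0 hd ?_ ?_
    (by linarith)⟩ <;> simp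

/-! ### The small root of `δ + l E + m δ E + q E²` -/

/-- The root `E` of `δ + l E + m δ E + q E²` that vanishes with `δ` when `0 < l`. It is written
with the square root in the denominator, so that `q = 0` is no exception. -/
noncomputable def smallRoot (l m q δ : ℝ) : ℝ :=
  -2 * δ / ((l + m * δ) + √((l + m * δ) ^ 2 - 4 * q * δ))

theorem tendsto_smallRoot_div {l : ℝ} (hl : 0 < l) (m q : ℝ) :
    Tendsto (fun δ => smallRoot l m q δ / δ) (𝓝[<] 0) (𝓝 (-1 / l)) := by
  have hc : ContinuousAt
      (fun δ : ℝ => -2 / ((l + m * δ) + √((l + m * δ) ^ 2 - 4 * q * δ))) 0 := by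
    refine ContinuousAt.div (by fun_prop) (by fun_prop) ?_
    simp [abs_of_pos hl, Real.sqrt_sq_eq_abs]
    positivity
  have h := hc.tendsto.mono_left (nhdsWithin_le_nhds (s := Iio 0))
  have hv : (-2 / ((l + m * 0) + √((l + m * 0) ^ 2 - 4 * q * 0)) : ℝ) = -1 / l := by
    simp only [mul_zero, add_zero, sub_zero, Real.sqrt_sq hl.le]
    field_simp
    norm_num
  rw [hv] at h
  refine h.congr' ?_
  filter_upwards [self_mem_nhdsWithin] with δ hδ
  have : δ ≠ 0 := ne_of_lt hδ
  rw [smallRoot]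
  field_simp

theorem tendsto_smallRoot {l : ℝ} (hl : 0 < l) (m q : ℝ) :
    Tendsto (smallRoot l m q) (𝓝[<] 0) (𝓝 0) := by
  have h := (tendsto_smallRoot_div hl m q).mul
    (tendsto_id.mono_left (nhdsWithin_le_nhds (s := Iio (0 : ℝ))))
  rw [mul_zero] at h
  refine h.congr' ?_
  filter_upwards [self_mem_nhdsWithin] with δ hδ
  have : δ ≠ 0 := ne_of_lt hδ
  simp only [id]
  field_simp

theorem eventually_smallRoot_isRoot {l : ℝ} (hl : 0 < l) (m q : ℝ) :
    ∀ᶠ δ in 𝓝[<] (0 : ℝ), δ + l * smallRoot l m q δ + m * δ * smallRoot l m q δ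
      + q * smallRoot l m q δ ^ 2 = 0 := by
  have h1 : ∀ᶠ δ in 𝓝 (0 : ℝ), 0 < l + m * δ :=
    ContinuousAt.eventually_lt (f := fun _ => (0 : ℝ)) (g := fun δ => l + m * δ)
      (by fun_prop) (by fun_prop) (by simpa)
  have h2 : ∀ᶠ δ in 𝓝 (0 : ℝ), 0 < (l + m * δ) ^ 2 - 4 * q * δ :=
    ContinuousAt.eventually_lt (f := fun _ => (0 : ℝ)) (g := fun δ => (l + m * δ) ^ 2 - 4 * q * δ)
      (by fun_prop) (by fun_prop) (by simp; positivity)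
  filter_upwards [nhdsWithin_le_nhds h1, nhdsWithin_le_nhds h2] with δ hN hD
  have hr := Real.sq_sqrt hD.le
  have hr0 := Real.sqrt_nonneg ((l + m * δ) ^ 2 - 4 * q * δ)
  set r := √((l + m * δ) ^ 2 - 4 * q * δ)
  have hS : (l + m * δ) + r ≠ 0 := by positivity
  obtain ⟨e, he⟩ : ∃ e, e = smallRoot l m q δ := ⟨_, rfl⟩
  have heS : e * ((l + m * δ) + r) = -2 * δ := by
    rw [he, smallRoot]
    exact div_mul_cancel₀ _ hS
  rw [← he]
  refine (mul_eq_zero.1 ?_).resolve_right (pow_ne_zero 2 hS)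
  linear_combination ((l + m * δ) * ((l + m * δ) + r)
    + q * (e * ((l + m * δ) + r) - 2 * δ)) * heS + δ * hr

theorem eventually_smallRoot_pos {l : ℝ} (hl : 0 < l) (m q : ℝ) :
    ∀ᶠ δ in 𝓝[<] (0 : ℝ), 0 < smallRoot l m q δ := by
  have h := (tendsto_smallRoot_div hl m q).eventually_lt_const
    (show -1 / l < 0 from div_neg_of_neg_of_pos (by norm_num) hl)
  filter_upwards [h, self_mem_nhdsWithin] with δ h1 h2
  exact (div_neg_iff.1 h1).elim (fun h => h.1) fun h => absurd h.2 (not_lt.2 (le_of_lt h2))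

theorem eventually_smallRoot_lt {l l' : ℝ} (hl : 0 < l) (hl' : l < l') (m q m' q' : ℝ) :
    ∀ᶠ δ in 𝓝[<] (0 : ℝ), smallRoot l' m' q' δ < smallRoot l m q δ := by
  have hlt : -1 / l < -1 / l' := by
    rw [neg_div, neg_div, neg_lt_neg_iff]
    exact one_div_lt_one_div_of_lt hl hl'
  filter_upwards [(tendsto_smallRoot_div hl m q).eventually_lt
    (tendsto_smallRoot_div (hl.trans hl') m' q') hlt, self_mem_nhdsWithin] with δ h1 h2
  exact (div_lt_div_right_of_neg h2).1 h1

/-- On a fixed interval `(0, ε)`, the sign of `δ + l E + m δ E + q E²` changes exactly at the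
small root, for all small `δ < 0`. -/
theorem eventually_sign_smallRoot {l : ℝ} (hl : 0 < l) (m q : ℝ) {ε : ℝ}
    (hε : 0 < ε) (hε' : 4 * |q| * ε ≤ l) :
    ∀ᶠ δ in 𝓝[<] (0 : ℝ), 0 < smallRoot l m q δ ∧ smallRoot l m q δ < ε ∧
      δ + l * smallRoot l m q δ + m * δ * smallRoot l m q δ + q * smallRoot l m q δ ^ 2 = 0 ∧
      ∀ E ∈ Ioo 0 ε,
      (E < smallRoot l m q δ → δ + l * E + m * δ * E + q * E ^ 2 < 0) ∧
      (smallRoot l m q δ < E → 0 < δ + l * E + m * δ * E + q * E ^ 2) := by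
  have h1 : ∀ᶠ δ in 𝓝 (0 : ℝ), 0 < l / 2 + m * δ :=
    ContinuousAt.eventually_lt (f := fun _ => (0 : ℝ)) (g := fun δ => l / 2 + m * δ)
      (by fun_prop) (by fun_prop) (by simpa)
  filter_upwards [nhdsWithin_le_nhds h1, eventually_smallRoot_pos hl m q,
    eventually_smallRoot_isRoot hl m q, (tendsto_smallRoot hl m q).eventually_lt_const hε]
    with δ hm he hr heε
  refine ⟨he, heε, hr, fun E hE => ?_⟩
  set e := smallRoot l m q δ
  have hq : |q * (E + e)| ≤ l / 2 := by
    rw [abs_mul, abs_of_pos (add_pos hE.1 he)]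
    nlinarith [abs_nonneg q, hE.2]
  have hpos : 0 < l + m * δ + q * (E + e) := by linarith [(abs_le.1 hq).1]
  have hfac : δ + l * E + m * δ * E + q * E ^ 2 = (E - e) * (l + m * δ + q * (E + e)) := by
    linear_combination hr
  rw [hfac]
  exact ⟨fun h => mul_neg_of_neg_of_pos (by linarith) hpos, fun h => mul_pos (by linarith) hpos⟩

/-- The expansion of the small root to second order: the truncated series is a root up to
`O(δ³)`, and the quadratic has slope near `l` there. -/
theorem smallRoot_isBigO {l : ℝ} (hl : 0 < l) (m q : ℝ) {T : ℝ → ℝ}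
    (hT : ∀ δ, T δ = -δ / l + (m / l ^ 2 - q / l ^ 3) * δ ^ 2) :
    (fun δ => smallRoot l m q δ - T δ) =O[𝓝[<] 0] fun δ => δ ^ 3 := by
  obtain ⟨κ, hκ⟩ : ∃ κ, κ = m / l ^ 2 - q / l ^ 3 := ⟨_, rfl⟩
  simp only [← hκ] at hT
  have hid : Tendsto (fun δ : ℝ => δ) (𝓝[<] 0) (𝓝 0) := nhdsWithin_le_nhds
  have hTt : Tendsto T (𝓝[<] 0) (𝓝 0) := by
    have hc : ContinuousAt T 0 := by rw [funext hT]; fun_prop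
    have := hc.tendsto.mono_left (nhdsWithin_le_nhds (s := Iio 0))
    simpa [hT] using this
  have hg : Tendsto (fun δ => l + m * δ + q * (smallRoot l m q δ + T δ)) (𝓝[<] 0) (𝓝 l) := by
    simpa using ((hid.const_mul m).const_add l).add
      (((tendsto_smallRoot hl m q).add hTt).const_mul q)
  have hnum : Tendsto (fun δ => -(m * κ - 2 * q * κ / l + q * κ ^ 2 * δ)) (𝓝[<] 0)
      (𝓝 (-(m * κ - 2 * q * κ / l + q * κ ^ 2 * 0))) :=
    ((hid.const_mul (q * κ ^ 2)).const_add _).neg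
  have hO := ((hnum.div hg hl.ne').isBigO_one ℝ).mul (isBigO_refl (fun δ : ℝ => δ ^ 3) (𝓝[<] 0))
  simp only [one_mul] at hO
  refine hO.congr' ?_ EventuallyEq.rfl
  filter_upwards [hg.eventually_ne hl.ne', eventually_smallRoot_isRoot hl m q] with δ h0 hr
  have hκl : l * κ - m / l + q / l ^ 2 = 0 := by
    rw [hκ]; field_simp; ring
  rw [Pi.div_apply, div_mul_eq_mul_div, div_eq_iff h0]
  have hT' : T δ + δ / l = κ * δ ^ 2 := by rw [hT]; ring
  have hPT : δ + l * T δ + m * δ * T δ + q * T δ ^ 2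
      = (m * κ - 2 * q * κ / l + q * κ ^ 2 * δ) * δ ^ 3 := by
    have hl' : l / l = 1 := div_self hl.ne'
    rw [hT]
    linear_combination δ ^ 2 * hκl - δ * hl'
  linear_combination hPT - hr

/-! ### The normal form as a polynomial in `J` -/

noncomputable section

/-- The value of `cos 2ψ` on a family. -/
def Family.sign : Family → ℝ
  | .inclined => 1
  | .loop => -1

theorem Family.cos_of_mem {X : Family} {ψ : ℝ} (h : ψ ∈ X.angles) :
    Real.cos (2 * ψ) = X.sign := by
  cases X
  · rcases h with rfl | rfl <;> simp [Family.sign]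
  · rcases h with rfl | rfl
    · rw [show 2 * (Real.pi / 2) = Real.pi by ring]; simp [Family.sign]
    · rw [show 2 * -(Real.pi / 2) = -Real.pi by ring]; simp [Family.sign]

theorem Family.sin_of_mem {X : Family} {ψ : ℝ} (h : ψ ∈ X.angles) :
    Real.sin (2 * ψ) = 0 := by
  cases X
  · rcases h with rfl | rfl <;> simp
  · rcases h with rfl | rfl
    · rw [show 2 * (Real.pi / 2) = Real.pi by ring]; simp
    · rw [show 2 * -(Real.pi / 2) = -Real.pi by ring]; simp

theorem Family.mem_Ioc_of_mem {X : Family} {ψ : ℝ} (h : ψ ∈ X.angles) :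
    ψ ∈ Ioc (-Real.pi) Real.pi := by
  have := Real.pi_pos
  cases X <;> rcases h with rfl | rfl <;> constructor <;> linarith

theorem Family.angles_nonempty (X : Family) : X.angles.Nonempty := by
  cases X
  · exact ⟨0, by simp [Family.angles]⟩
  · exact ⟨Real.pi / 2, by simp [Family.angles]⟩

theorem mem_angles_of_sin_eq_zero {ψ : ℝ} (h : ψ ∈ Ioc (-Real.pi) Real.pi)
    (hs : Real.sin (2 * ψ) = 0) :
    ψ ∈ Family.inclined.angles ∨ ψ ∈ Family.loop.angles := by
  have hpi := Real.pi_pos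
  obtain ⟨n, hn⟩ := Real.sin_eq_zero_iff.1 hs
  have h1 : (-2 : ℝ) < n := by
    by_contra hc
    nlinarith [h.1]
  have h2 : (n : ℝ) ≤ 2 := by
    by_contra hc
    nlinarith [h.2]
  have h1' : -2 < n := by exact_mod_cast h1
  have h2' : n ≤ 2 := by exact_mod_cast h2
  simp only [Family.angles, mem_insert_iff, mem_singleton_iff]
  interval_cases n
  · right; right; push_cast at hn; linarith
  · left; left; push_cast at hn; linarith
  · right; left; push_cast at hn; linarith
  · left; right; push_cast at hn; linarith

namespace ResCoeffs

/-- Coefficient of `E² J` in the phase-independent part of the normal form. -/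
def α (p : ResCoeffs) : ℝ :=
  68 / 3 * p.A ^ 2 - 68 / 3 * p.A * p.B + 17 / 3 * p.B ^ 2 - 32 * p.A * p.C
    + 16 * p.B * p.C - 36 * p.C ^ 2 + 3 / 2 * p.v24 - 15 / 2 * p.v06

/-- Coefficient of `E J²` in the phase-independent part of the normal form. -/
def β (p : ResCoeffs) : ℝ :=
  68 / 3 * p.A * p.B - 68 / 3 * p.A ^ 2 - 17 / 3 * p.B ^ 2 + 32 * p.A * p.C
    - 48 * p.B * p.C + 36 * p.C ^ 2 + 3 / 2 * p.v42 - 3 * p.v24 + 15 / 2 * p.v06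

/-- Coefficient of `E` in the phase-dependent part of the normal form, after division by
`J (E - J) cos 2ψ`. -/
def γ (p : ResCoeffs) : ℝ :=
  p.v24 - 32 * p.C ^ 2 - 40 / 3 * p.A * p.C + 20 / 3 * p.B * p.C

/-- Coefficient of `J` in the phase-independent part of the normal form. -/
def a₁ (p : ResCoeffs) (δ E : ℝ) : ℝ :=
  δ + (-4 * p.A + 2 * p.B + 8 * p.C) * E - 8 * p.C * δ * E + p.α * E ^ 2

/-- Coefficient of `J²` in the phase-independent part of the normal form. -/
def a₂ (p : ResCoeffs) (δ E : ℝ) : ℝ :=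
  4 * (p.A - 2 * p.C) + p.β * E + 2 * (4 * p.C - 2 * p.A - p.B) * δ

/-- Coefficient of `J³` in the phase-independent part of the normal form. -/
def a₃ (p : ResCoeffs) : ℝ :=
  32 * p.B * p.C + 5 / 2 * p.v60 - 136 / 9 * p.A * p.B - 3 / 2 * p.v42
    + 3 / 2 * p.v24 - 5 / 2 * p.v06

/-- Constant term, in `J`, of the second factor of the phase-dependent part
`J (E - J) (b₀ + b₁ J) cos 2ψ` of the normal form. -/
def b₀ (p : ResCoeffs) (δ E : ℝ) : ℝ := 4 * p.C - 4 * p.C * δ + p.γ * E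

/-- Coefficient of `J` in the second factor of the phase-dependent part
`J (E - J) (b₀ + b₁ J) cos 2ψ` of the normal form. -/
def b₁ (p : ResCoeffs) : ℝ := p.v42 - p.v24 - 40 / 3 * p.B * p.C

/-- The phase-independent part of the normal form. -/
def phaseFree (p : ResCoeffs) (δ E J : ℝ) : ℝ :=
  p.normalForm δ 0 E 0 + p.a₁ δ E * J + p.a₂ δ E * J ^ 2 + p.a₃ * J ^ 3

/-- The derivative of `phaseFree` in `J`. -/
def phaseFreeDeriv (p : ResCoeffs) (δ E J : ℝ) : ℝ :=
  p.a₁ δ E + 2 * p.a₂ δ E * J + 3 * p.a₃ * J ^ 2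

/-- The factor of `cos 2ψ` in the normal form. -/
def phaseAmp (p : ResCoeffs) (δ E J : ℝ) : ℝ := J * (E - J) * (p.b₀ δ E + p.b₁ * J)

/-- The derivative of `phaseAmp` in `J`. -/
def phaseAmpDeriv (p : ResCoeffs) (δ E J : ℝ) : ℝ :=
  E * p.b₀ δ E + 2 * (E * p.b₁ - p.b₀ δ E) * J - 3 * p.b₁ * J ^ 2

theorem normalForm_eq (p : ResCoeffs) (δ E J w : ℝ) :
    p.normalForm δ J (E - J) w = p.phaseFree δ E J + w * (p.b₀ δ E + p.b₁ * J) := by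
  simp only [phaseFree, normalForm, a₁, a₂, a₃, b₀, b₁, α, β, γ, A, B, C]
  ring

theorem K_eq_phase (p : ResCoeffs) (δ E : ℝ) (z : ℝ × ℝ) :
    p.K δ E z = p.phaseFree δ E z.1 + p.phaseAmp δ E z.1 * Real.cos (2 * z.2) := by
  rw [K, normalForm_eq, phaseAmp]
  ring

theorem hasDerivAt_phaseFree (p : ResCoeffs) (δ E J : ℝ) :
    HasDerivAt (p.phaseFree δ E) (p.phaseFreeDeriv δ E J) J := by
  have h := hasDerivAt_id J
  have := (((h.const_mul (p.a₁ δ E)).const_add (p.normalForm δ 0 E 0)).add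
    ((h.pow 2).const_mul (p.a₂ δ E))).add ((h.pow 3).const_mul p.a₃)
  refine (this.congr_deriv ?_).congr_of_eventuallyEq (Eventually.of_forall fun x => ?_)
  · simp [phaseFreeDeriv]; ring
  · simp [phaseFree]

theorem hasDerivAt_phaseAmp (p : ResCoeffs) (δ E J : ℝ) :
    HasDerivAt (p.phaseAmp δ E) (p.phaseAmpDeriv δ E J) J := by
  have h := hasDerivAt_id J
  have := (h.mul (h.const_sub E)).mul ((h.const_mul p.b₁).const_add (p.b₀ δ E))
  refine (this.congr_deriv ?_).congr_of_eventuallyEq (Eventually.of_forall fun x => ?_)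
  · simp [phaseAmpDeriv]; ring
  · simp [phaseAmp]

theorem hasDerivAt_phaseFreeDeriv (p : ResCoeffs) (δ E J : ℝ) :
    HasDerivAt (p.phaseFreeDeriv δ E) (2 * p.a₂ δ E + 6 * p.a₃ * J) J := by
  have h := hasDerivAt_id J
  have := ((h.const_mul (2 * p.a₂ δ E)).const_add (p.a₁ δ E)).add
    ((h.pow 2).const_mul (3 * p.a₃))
  refine (this.congr_deriv ?_).congr_of_eventuallyEq (Eventually.of_forall fun x => ?_)
  · simp; ring
  · simp [phaseFreeDeriv]

theorem hasDerivAt_phaseAmpDeriv (p : ResCoeffs) (δ E J : ℝ) :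
    HasDerivAt (p.phaseAmpDeriv δ E)
      (2 * (E * p.b₁ - p.b₀ δ E) - 6 * p.b₁ * J) J := by
  have h := hasDerivAt_id J
  have := ((h.const_mul (2 * (E * p.b₁ - p.b₀ δ E))).const_add (E * p.b₀ δ E)).sub
    ((h.pow 2).const_mul (3 * p.b₁))
  refine (this.congr_deriv ?_).congr_of_eventuallyEq (Eventually.of_forall fun x => ?_)
  · simp; ring
  · simp [phaseAmpDeriv]

/-- The phase velocity `ψ' = ∂K/∂J` on the lines `ψ ∈ X.angles`. Its zeros in `(0, E)` are the
fixed points of the family, and its values at the end points are, up to sign, the entries of the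
Hessian of the Hamiltonian at the normal modes. -/
def freq (p : ResCoeffs) (δ : ℝ) (X : Family) (E J : ℝ) : ℝ :=
  p.phaseFreeDeriv δ E J + X.sign * p.phaseAmpDeriv δ E J

/-- The difference quotient of `freq` between two points with sum `T`; it depends on the points
only through `T` since `freq` is quadratic in `J`. -/
def freqSlope (p : ResCoeffs) (δ : ℝ) (X : Family) (E T : ℝ) : ℝ :=
  2 * p.a₂ δ E + 3 * p.a₃ * T + X.sign * (2 * (E * p.b₁ - p.b₀ δ E) - 3 * p.b₁ * T)

theorem freq_sub (p : ResCoeffs) (δ : ℝ) (X : Family) (E J J' : ℝ) :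
    p.freq δ X E J - p.freq δ X E J' = (J - J') * p.freqSlope δ X E (J + J') := by
  simp only [freq, freqSlope, phaseFreeDeriv, phaseAmpDeriv]
  ring

theorem continuous_freq (p : ResCoeffs) (δ : ℝ) (X : Family) :
    Continuous fun z : ℝ × ℝ => p.freq δ X z.1 z.2 := by
  unfold freq phaseFreeDeriv phaseAmpDeriv a₁ a₂ b₀
  fun_prop

theorem hamField_K (p : ResCoeffs) (δ E : ℝ) (z : ℝ × ℝ) :
    hamField (p.K δ E) z = (2 * (p.phaseAmp δ E z.1 * Real.sin (2 * z.2)),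
      p.phaseFreeDeriv δ E z.1 + p.phaseAmpDeriv δ E z.1 * Real.cos (2 * z.2)) :=
  hamField_action_angle (p.K_eq_phase δ E) (p.hasDerivAt_phaseFree δ E)
    (p.hasDerivAt_phaseAmp δ E) z

theorem hamField_K_eq_zero_iff (p : ResCoeffs) (δ E : ℝ) {X : Family} {z : ℝ × ℝ}
    (hz : z.2 ∈ X.angles) : hamField (p.K δ E) z = 0 ↔ p.freq δ X E z.1 = 0 := by
  rw [hamField_K, Family.sin_of_mem hz, Family.cos_of_mem hz, freq, mul_comm X.sign]
  simp

/-- At a fixed point of the family, with `∂²K/∂J²` positive, the type is decided by the sign of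
`∂²K/∂ψ²`. -/
theorem hasNature_K (p : ResCoeffs) (δ E : ℝ) {X : Family} {z : ℝ × ℝ} (hz : z.2 ∈ X.angles)
    (h0 : p.freq δ X E z.1 = 0) (hs : 0 < p.freqSlope δ X E (z.1 + z.1)) :
    (X.sign * p.phaseAmp δ E z.1 < 0 → HasNature (p.K δ E) z .stable) ∧
    (0 < X.sign * p.phaseAmp δ E z.1 → HasNature (p.K δ E) z .unstable) := by
  obtain ⟨L, hL, h₁, h₂⟩ := hasFDerivAt_hamField_action_angle (p.K_eq_phase δ E)
    (p.hasDerivAt_phaseFree δ E) (p.hasDerivAt_phaseAmp δ E)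
    (p.hasDerivAt_phaseFreeDeriv δ E z.1) (p.hasDerivAt_phaseAmpDeriv δ E z.1)
    (Family.sin_of_mem hz) (Family.cos_of_mem hz)
  have h0' := (p.hamField_K_eq_zero_iff δ E hz).2 h0
  have hslope : 2 * p.a₂ δ E + 6 * p.a₃ * z.1 +
      X.sign * (2 * (E * p.b₁ - p.b₀ δ E) - 6 * p.b₁ * z.1)
      = p.freqSlope δ X E (z.1 + z.1) := by
    rw [freqSlope]; ring
  rw [hslope] at h₁
  exact ⟨fun h => hasNature_stable h0' hL h₁ h₂ (mul_neg_of_pos_of_neg hs (by linarith)),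
    fun h => hasNature_unstable h0' hL h₁ h₂ (mul_pos hs (by linarith))⟩

/-- The type of a normal mode is decided by the sign of the product of the two phase velocities
there. -/
theorem modeNature_of_freq (p : ResCoeffs) (δ E : ℝ) (k : Mode) :
    (0 < p.freq δ .inclined E (k.J E) * p.freq δ .loop E (k.J E) →
      ModeNature p δ E k .stable) ∧
    (p.freq δ .inclined E (k.J E) * p.freq δ .loop E (k.J E) < 0 →
      ModeNature p δ E k .unstable) := by
  have hd : Differentiable ℝ (p.phaseFreeDeriv δ E) := fun x =>
    (p.hasDerivAt_phaseFreeDeriv δ E x).differentiableAt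
  cases k
  · have hb (x : ℝ) : HasDerivAt (fun J => (E - J) * (p.b₀ δ E + p.b₁ * J))
        (E * p.b₁ - p.b₀ δ E - 2 * p.b₁ * x) x := by
      have h := hasDerivAt_id x
      refine ((h.const_sub E).mul ((h.const_mul p.b₁).const_add (p.b₀ δ E))).congr_deriv ?_
      simp; ring
    have := hasNature_planar_origin (H := p.planarK₁ δ E) (fun z => by
      rw [planarK₁, normalForm_eq]; ring) (p.hasDerivAt_phaseFree δ E) hb hd (by fun_prop)
    refine ⟨fun h => this.1 (h.trans_eq ?_), fun h => this.2 (lt_of_eq_of_lt ?_ h)⟩ <;>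
    · simp only [Mode.J, freq, phaseAmpDeriv, Family.sign]
      ring
  · have ha (x : ℝ) : HasDerivAt (fun J => p.phaseFree δ E (E - J))
        (-p.phaseFreeDeriv δ E (E - x)) x := by
      exact ((p.hasDerivAt_phaseFree δ E (E - x)).comp x
        ((hasDerivAt_id x).const_sub E)).congr_deriv (by simp)
    have hb (x : ℝ) : HasDerivAt (fun J => (E - J) * (p.b₀ δ E + p.b₁ * (E - J)))
        (-p.b₀ δ E - 2 * p.b₁ * (E - x)) x := by
      have h := (hasDerivAt_id x).const_sub E
      refine (h.mul ((h.const_mul p.b₁).const_add (p.b₀ δ E))).congr_deriv ?_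
      simp; ring
    have := hasNature_planar_origin (H := p.planarK₂ δ E) (fun z => by
      have h := p.normalForm_eq δ E (E - (z.1 ^ 2 + z.2 ^ 2) / 2)
        ((E - (z.1 ^ 2 + z.2 ^ 2) / 2) * ((z.1 ^ 2 - z.2 ^ 2) / 2))
      rw [sub_sub_cancel] at h
      rw [planarK₂, h]; ring) ha hb (by fun_prop) (by fun_prop)
    refine ⟨fun h => this.1 (h.trans_eq ?_), fun h => this.2 (lt_of_eq_of_lt ?_ h)⟩ <;>
    · simp only [Mode.J, freq, phaseAmpDeriv, Family.sign, sub_zero]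
      ring

/-! ### The thresholds -/

/-- Coefficient of `E` in the phase velocity at a normal mode. -/
def modeLin (p : ResCoeffs) (X : Family) : Mode → ℝ
  | .one => 2 * (p.B - 2 * p.A + 4 * p.C + 2 * X.sign * p.C)
  | .two => 2 * (2 * p.A + p.B - 4 * p.C - 2 * X.sign * p.C)

/-- Coefficient of `δ E` in the phase velocity at a normal mode. -/
def modeMix (p : ResCoeffs) (X : Family) : Mode → ℝ
  | .one => -8 * p.C - 4 * X.sign * p.C
  | .two => 8 * p.C - 8 * p.A - 4 * p.B + 4 * X.sign * p.C

/-- Coefficient of `E²` in the phase velocity at a normal mode. -/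
def modeQuad (p : ResCoeffs) (X : Family) : Mode → ℝ
  | .one => p.α + X.sign * p.γ
  | .two => p.α + 2 * p.β + 3 * p.a₃ - X.sign * (p.γ + p.b₁)

theorem freq_mode (p : ResCoeffs) (δ : ℝ) (X : Family) (E : ℝ) (k : Mode) :
    p.freq δ X E (k.J E) = δ + p.modeLin X k * E + p.modeMix X k * δ * E
      + p.modeQuad X k * E ^ 2 := by
  cases k <;> simp only [freq, phaseFreeDeriv, phaseAmpDeriv, Mode.J, modeLin, modeMix, modeQuad,
    a₁, a₂, b₀] <;> ring

/-- The value of `E` at which the family `X` branches off the normal mode `k`. -/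
def threshold (p : ResCoeffs) (k : Mode) (X : Family) : ℝ → ℝ :=
  smallRoot (p.modeLin X k) (p.modeMix X k) (p.modeQuad X k)

/-- The second order expansion of a threshold. -/
def expansion (p : ResCoeffs) (k : Mode) (X : Family) (δ : ℝ) : ℝ :=
  -δ / p.modeLin X k
    + (p.modeMix X k / p.modeLin X k ^ 2 - p.modeQuad X k / p.modeLin X k ^ 3) * δ ^ 2

theorem E1I_eq (p : ResCoeffs) (h : 2 * (p.A - 3 * p.C) < p.B) :
    p.E1I = p.expansion .one .inclined := by
  funext δ
  have hD : 2 * p.A - p.B - 6 * p.C ≠ 0 := by intro h'; linarith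
  have hl : p.modeLin .inclined .one = -2 * (2 * p.A - p.B - 6 * p.C) := by
    simp only [modeLin, Family.sign]; ring
  rw [E1I, expansion, hl]
  simp only [modeMix, modeQuad, Family.sign, α, γ]
  -- Eliminating `B` makes the denominator a variable.
  generalize hx : 2 * p.A - p.B - 6 * p.C = D at *
  obtain hB : p.B = 2 * p.A - 6 * p.C - D := by linarith
  rw [hB]
  field_simp
  ring

theorem E1L_eq (p : ResCoeffs) (h : 2 * (p.A - p.C) < p.B) :
    p.E1L = p.expansion .one .loop := by
  funext δ
  have hD : 2 * p.A - p.B - 2 * p.C ≠ 0 := by intro h'; linarith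
  have hl : p.modeLin .loop .one = -2 * (2 * p.A - p.B - 2 * p.C) := by
    simp only [modeLin, Family.sign]; ring
  rw [E1L, expansion, hl]
  simp only [modeMix, modeQuad, Family.sign, α, γ]
  generalize hx : 2 * p.A - p.B - 2 * p.C = D at *
  obtain hB : p.B = 2 * p.A - 2 * p.C - D := by linarith
  rw [hB]
  field_simp
  ring

theorem E2I_eq (p : ResCoeffs) (h : 2 * (3 * p.C - p.A) < p.B) :
    p.E2I = p.expansion .two .inclined := by
  funext δ
  have hD : 2 * p.A + p.B - 6 * p.C ≠ 0 := by intro h'; linarith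
  have hl : p.modeLin .inclined .two = 2 * (2 * p.A + p.B - 6 * p.C) := by
    simp only [modeLin, Family.sign]; ring
  rw [E2I, expansion, hl]
  simp only [modeMix, modeQuad, Family.sign, α, β, γ, a₃, b₁]
  generalize hx : 2 * p.A + p.B - 6 * p.C = D at *
  obtain hB : p.B = D - 2 * p.A + 6 * p.C := by linarith
  rw [hB]
  field_simp
  ring

theorem E2L_eq (p : ResCoeffs) (h : 2 * (p.C - p.A) < p.B) :
    p.E2L = p.expansion .two .loop := by
  funext δ
  have hD : 2 * p.A + p.B - 2 * p.C ≠ 0 := by intro h'; linarith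
  have hl : p.modeLin .loop .two = 2 * (2 * p.A + p.B - 2 * p.C) := by
    simp only [modeLin, Family.sign]; ring
  rw [E2L, expansion, hl]
  simp only [modeMix, modeQuad, Family.sign, α, β, γ, a₃, b₁]
  generalize hx : 2 * p.A + p.B - 2 * p.C = D at *
  obtain hB : p.B = D - 2 * p.A + 2 * p.C := by linarith
  rw [hB]
  field_simp
  ring

/-! ### Fixed points for small energy and detuning -/

/-- The range of parameters in which the leading terms decide: for `0 < E < ε` the phase
velocities increase along `0 ≤ J ≤ E` with slope at least `m`, the factor
`b₀ + b₁ J` has the sign of `C`, and the phase velocity of the family `X` at the mode `k` changes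
sign, from negative to positive, exactly at `e k X`. -/
structure IsRegime (p : ResCoeffs) (δ ε m : ℝ) (e : Mode → Family → ℝ) : Prop where
  pos : 0 < m
  slope : ∀ X, ∀ E ∈ Ioo 0 ε, ∀ T ∈ Icc 0 (2 * E), m ≤ p.freqSlope δ X E T
  amp : ∀ E ∈ Ioo 0 ε, ∀ J ∈ Icc 0 E, 0 < p.C * (p.b₀ δ E + p.b₁ * J)
  mem : ∀ k X, e k X ∈ Ioo 0 ε
  zero : ∀ k X, p.freq δ X (e k X) (k.J (e k X)) = 0
  neg : ∀ k X, ∀ E ∈ Ioo 0 ε, E < e k X → p.freq δ X E (k.J E) < 0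
  pos_of_lt : ∀ k X, ∀ E ∈ Ioo 0 ε, e k X < E → 0 < p.freq δ X E (k.J E)

theorem mem_familyPoints_iff (p : ResCoeffs) (δ E : ℝ) (X : Family) (z : ℝ × ℝ) :
    z ∈ familyPoints p δ E X ↔
      z.2 ∈ X.angles ∧ z.1 ∈ Ioo 0 E ∧ p.freq δ X E z.1 = 0 := by
  constructor
  · rintro ⟨⟨h1, h2, -, h0⟩, hz⟩
    exact ⟨hz, ⟨h1, h2⟩, (p.hamField_K_eq_zero_iff δ E hz).1 h0⟩
  · rintro ⟨hz, ⟨h1, h2⟩, h0⟩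
    exact ⟨⟨h1, h2, Family.mem_Ioc_of_mem hz, (p.hamField_K_eq_zero_iff δ E hz).2 h0⟩, hz⟩

theorem isPair_freq {p : ResCoeffs} {δ E J : ℝ} {X : Family} {s : Nature}
    (h : IsPair p δ E X s J) : J ∈ Ioo 0 E ∧ p.freq δ X E J = 0 := by
  obtain ⟨ψ, hψ⟩ := X.angles_nonempty
  have : (J, ψ) ∈ familyPoints p δ E X := by
    rw [h.1]
    exact ⟨rfl, hψ⟩
  exact ((p.mem_familyPoints_iff δ E X _).1 this).2

variable {p : ResCoeffs} {δ ε m : ℝ} {e : Mode → Family → ℝ}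

namespace IsRegime

/-- The phase velocity grows at least linearly along `0 ≤ J ≤ E`. -/
theorem mul_sub_le (h : p.IsRegime δ ε m e) (X : Family) {E J J' : ℝ} (hE : E ∈ Ioo 0 ε)
    (hJ : J ∈ Icc 0 E) (hJ' : J' ∈ Icc 0 E) (hle : J' ≤ J) :
    m * (J - J') ≤ p.freq δ X E J - p.freq δ X E J' := by
  rw [freq_sub, mul_comm m]
  exact mul_le_mul_of_nonneg_left
    (h.slope X E hE _ ⟨add_nonneg hJ.1 hJ'.1, by linarith [hJ.2, hJ'.2]⟩) (sub_nonneg.2 hle)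

theorem fixedPoints_eq (h : p.IsRegime δ ε m e) {E : ℝ} (hE : E ∈ Ioo 0 ε) :
    fixedPoints p δ E = familyPoints p δ E .inclined ∪ familyPoints p δ E .loop := by
  ext z
  constructor
  · intro hz
    have h0 := congrArg Prod.fst hz.2.2.2
    rw [hamField_K] at h0
    have hamp := h.amp E hE z.1 ⟨hz.1.le, hz.2.1.le⟩
    have hne : p.phaseAmp δ E z.1 ≠ 0 :=
      mul_ne_zero (mul_ne_zero hz.1.ne' (sub_ne_zero.2 hz.2.1.ne')) (right_ne_zero_of_mul hamp.ne')
    have hs : Real.sin (2 * z.2) = 0 := by simpa [hne] using h0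
    exact (mem_angles_of_sin_eq_zero hz.2.2.1 hs).imp (fun h => ⟨hz, h⟩) fun h => ⟨hz, h⟩
  · rintro (hz | hz) <;> exact hz.1

/-- Past its thresholds a family is empty, as the phase velocity has a fixed sign inside
`(0, E)`. -/
theorem familyPoints_eq_empty (h : p.IsRegime δ ε m e) (X : Family) {E : ℝ} (hE : E ∈ Ioo 0 ε)
    (hE' : E ∉ Ioo (e .two X) (e .one X)) : familyPoints p δ E X = ∅ := by
  refine eq_empty_of_forall_notMem fun z hz => ?_
  obtain ⟨-, hJ, h0⟩ := (p.mem_familyPoints_iff δ E X z).1 hz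
  have hm := h.pos
  rcases le_or_gt E (e .two X) with h2 | h2
  · have hle : p.freq δ X E E ≤ 0 := by
      rcases h2.eq_or_lt with rfl | h2
      · exact (h.zero .two X).le
      · exact (h.neg .two X E hE h2).le
    have := h.mul_sub_le X hE ⟨hE.1.le, le_rfl⟩ ⟨hJ.1.le, hJ.2.le⟩ hJ.2.le
    nlinarith [mul_pos hm (sub_pos.2 hJ.2)]
  · have h1 : e .one X ≤ E := not_lt.1 fun h1 => hE' ⟨h2, h1⟩
    have hle : 0 ≤ p.freq δ X E 0 := by
      rcases h1.eq_or_lt with h1 | h1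
      · rw [← h1]
        exact (h.zero .one X).ge
      · exact (h.pos_of_lt .one X E hE h1).le
    have := h.mul_sub_le X hE ⟨hJ.1.le, hJ.2.le⟩ ⟨le_rfl, hE.1.le⟩ hJ.1.le
    nlinarith [mul_pos hm hJ.1]

/-- Between its thresholds a family is a pair: the phase velocity is negative at `J = 0`,
positive at `J = E`, and increasing. -/
theorem exists_familyPoints_eq (h : p.IsRegime δ ε m e) (X : Family) {E : ℝ} (hE : E ∈ Ioo 0 ε)
    (hE' : E ∈ Ioo (e .two X) (e .one X)) : ∃ J, familyPoints p δ E X = {J} ×ˢ X.angles := by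
  have h0 : p.freq δ X E 0 < 0 := h.neg .one X E hE hE'.2
  have h1 : 0 < p.freq δ X E E := h.pos_of_lt .two X E hE hE'.1
  have hc : Continuous (p.freq δ X E) :=
    (p.continuous_freq δ X).comp (Continuous.prodMk_right E)
  obtain ⟨J, hJ, hJ0⟩ := intermediate_value_Ioo hE.1.le hc.continuousOn ⟨h0, h1⟩
  refine ⟨J, ?_⟩
  ext z
  rw [mem_familyPoints_iff, mem_prod, mem_singleton_iff]
  constructor
  · rintro ⟨hz, hz1, hz0⟩
    refine ⟨?_, hz⟩
    rcases le_total J z.1 with hle | hle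
    · have := h.mul_sub_le X hE (Ioo_subset_Icc_self hz1) (Ioo_subset_Icc_self hJ) hle
      nlinarith [h.pos]
    · have := h.mul_sub_le X hE (Ioo_subset_Icc_self hJ) (Ioo_subset_Icc_self hz1) hle
      nlinarith [h.pos]
  · rintro ⟨hz1, hz⟩
    rw [hz1]
    exact ⟨hz, hJ, hJ0⟩

theorem phaseAmp_pos (h : p.IsRegime δ ε m e) {E J : ℝ} (hE : E ∈ Ioo 0 ε) (hJ : J ∈ Ioo 0 E) :
    0 < p.C * p.phaseAmp δ E J := by
  have := mul_pos (mul_pos hJ.1 (sub_pos.2 hJ.2)) (h.amp E hE J (Ioo_subset_Icc_self hJ))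
  rw [phaseAmp]
  linarith

theorem exists_isPair_stable (h : p.IsRegime δ ε m e) {X : Family} (hX : X.sign * p.C < 0)
    {E : ℝ} (hE : E ∈ Ioo 0 ε) (hE' : E ∈ Ioo (e .two X) (e .one X)) :
    ∃ J, IsPair p δ E X .stable J := by
  obtain ⟨J, hJ⟩ := h.exists_familyPoints_eq X hE hE'
  refine ⟨J, hJ, fun z hz => ?_⟩
  obtain ⟨hψ, hz1, hz0⟩ := (p.mem_familyPoints_iff δ E X z).1 hz
  have hs := h.pos.trans_le
    (h.slope X E hE (z.1 + z.1) ⟨by linarith [hz1.1], by linarith [hz1.2]⟩)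
  refine (p.hasNature_K δ E hψ hz0 hs).1 ?_
  have hC : 0 < p.C ^ 2 := sq_pos_iff.2 (right_ne_zero_of_mul hX.ne)
  have := mul_neg_of_neg_of_pos hX (h.phaseAmp_pos hE hz1)
  by_contra hcon
  nlinarith [mul_nonneg hC.le (not_lt.1 hcon)]

theorem exists_isPair_unstable (h : p.IsRegime δ ε m e) {X : Family} (hX : 0 < X.sign * p.C)
    {E : ℝ} (hE : E ∈ Ioo 0 ε) (hE' : E ∈ Ioo (e .two X) (e .one X)) :
    ∃ J, IsPair p δ E X .unstable J := by
  obtain ⟨J, hJ⟩ := h.exists_familyPoints_eq X hE hE'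
  refine ⟨J, hJ, fun z hz => ?_⟩
  obtain ⟨hψ, hz1, hz0⟩ := (p.mem_familyPoints_iff δ E X z).1 hz
  have hs := h.pos.trans_le
    (h.slope X E hE (z.1 + z.1) ⟨by linarith [hz1.1], by linarith [hz1.2]⟩)
  refine (p.hasNature_K δ E hψ hz0 hs).2 ?_
  have hC : 0 < p.C ^ 2 := sq_pos_iff.2 (right_ne_zero_of_mul hX.ne')
  have := mul_pos hX (h.phaseAmp_pos hE hz1)
  by_contra hcon
  nlinarith [mul_nonneg hC.le (sub_nonneg.2 (not_lt.1 hcon))]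

/-- A pair is no farther from a mode than `1 / m` times the phase velocity at the mode. -/
theorem abs_sub_mode_le (h : p.IsRegime δ ε m e) {X : Family} {s : Nature} {E J : ℝ}
    (hE : E ∈ Ioo 0 ε) (hJ : IsPair p δ E X s J) (k : Mode) :
    |J - k.J E| ≤ |p.freq δ X E (k.J E)| / m := by
  obtain ⟨hJ, h0⟩ := isPair_freq hJ
  rw [le_div_iff₀ h.pos]
  cases k
  · have := h.mul_sub_le X hE (Ioo_subset_Icc_self hJ) ⟨le_rfl, hE.1.le⟩ hJ.1.le
    simp only [Mode.J]
    rw [abs_of_nonneg (by linarith [hJ.1])]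
    linarith [neg_le_abs (p.freq δ X E 0)]
  · have := h.mul_sub_le X hE ⟨hE.1.le, le_rfl⟩ (Ioo_subset_Icc_self hJ) hJ.2.le
    simp only [Mode.J]
    rw [abs_of_nonpos (by linarith [hJ.2])]
    linarith [le_abs_self (p.freq δ X E E)]

/-- At a threshold of the family the pair, where it exists, merges with the mode, because the
phase velocity at the mode tends to `0`. -/
theorem pitchforkOn (h : p.IsRegime δ ε m e) {X : Family} {s : Nature} {k : Mode}
    {absent present : Filter ℝ} (hp : present ≤ 𝓝 (e k X))
    (h₁ : ∀ᶠ E in absent, familyPoints p δ E X = ∅ ∧ ModeNature p δ E k s)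
    (h₂ : ∀ᶠ E in present, (∃ J, IsPair p δ E X s J) ∧ ModeNature p δ E k s.opp) :
    PitchforkOn p δ k X s (e k X) absent present := by
  have hspec : ∀ᶠ E in present, IsPair p δ E X s (Classical.epsilon (IsPair p δ E X s)) :=
    h₂.mono fun E hE => Classical.epsilon_spec hE.1
  refine ⟨h₁, fun E => Classical.epsilon (IsPair p δ E X s), ?_, ?_⟩
  · filter_upwards [hspec, h₂] with E h3 h4 using ⟨h3, h4.2⟩
  · have hJc : Continuous fun E => k.J E := by
      cases k
      · exact continuous_const
      · exact continuous_id
    have hf : Continuous fun E => |p.freq δ X E (k.J E)| / m :=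
      ((p.continuous_freq δ X).comp (continuous_id.prodMk hJc)).abs.div_const m
    have hf0 := (hf.tendsto (e k X)).mono_left hp
    rw [h.zero k X, abs_zero, zero_div] at hf0
    have hlim := squeeze_zero_norm' (f := fun E =>
        Classical.epsilon (IsPair p δ E X s) - k.J E) (by
      filter_upwards [hspec, hp (Ioo_mem_nhds (h.mem k X).1 (h.mem k X).2)] with E h3 hE
      exact h.abs_sub_mode_le hE h3 k) hf0
    simpa using hlim.add ((hJc.tendsto (e k X)).mono_left hp)

theorem freq_mul_freq {X Y : Family} (hX : X.sign * p.C < 0) (hY : 0 < Y.sign * p.C) (E J : ℝ) :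
    p.freq δ .inclined E J * p.freq δ .loop E J = p.freq δ X E J * p.freq δ Y E J := by
  cases X <;> cases Y
  · exact absurd hX hY.not_gt
  · rfl
  · exact mul_comm _ _
  · exact absurd hX hY.not_gt

/-- The bifurcation sequence, for both signs of `C`: `X` is the family that is stable. -/
theorem fullSequence (h : p.IsRegime δ ε m e) {X Y : Family} (hX : X.sign * p.C < 0)
    (hY : 0 < Y.sign * p.C) (hab : e .two X < e .two Y) (hbc : e .two Y < e .one Y)
    (hcd : e .one Y < e .one X) :
    FullSequence p δ ε X Y (e .two X) (e .two Y) (e .one Y) (e .one X) := by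
  have hmem := h.mem
  have hstab (k : Mode) (E : ℝ) (hp : 0 < p.freq δ X E (k.J E) * p.freq δ Y E (k.J E)) :
      ModeNature p δ E k .stable :=
    (p.modeNature_of_freq δ E k).1 (by rwa [freq_mul_freq hX hY])
  have hunst (k : Mode) (E : ℝ) (hp : p.freq δ X E (k.J E) * p.freq δ Y E (k.J E) < 0) :
      ModeNature p δ E k .unstable :=
    (p.modeNature_of_freq δ E k).2 (by rwa [freq_mul_freq hX hY])
  have two_stable : ∀ E ∈ Ioo 0 ε, E < e .two X ∨ e .two Y < E →
      ModeNature p δ E .two .stable := by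
    rintro E hE (hlt | hlt)
    · exact hstab .two E
        (mul_pos_of_neg_of_neg (h.neg .two X E hE hlt) (h.neg .two Y E hE (hlt.trans hab)))
    · exact hstab .two E
        (mul_pos (h.pos_of_lt .two X E hE (hab.trans hlt)) (h.pos_of_lt .two Y E hE hlt))
  have two_unstable : ∀ E ∈ Ioo 0 ε, E ∈ Ioo (e .two X) (e .two Y) →
      ModeNature p δ E .two .unstable := fun E hE hlt => hunst .two E
    (mul_neg_of_pos_of_neg (h.pos_of_lt .two X E hE hlt.1) (h.neg .two Y E hE hlt.2))
  have one_stable : ∀ E ∈ Ioo 0 ε, E < e .one Y ∨ e .one X < E →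
      ModeNature p δ E .one .stable := by
    rintro E hE (hlt | hlt)
    · exact hstab .one E
        (mul_pos_of_neg_of_neg (h.neg .one X E hE (hlt.trans hcd)) (h.neg .one Y E hE hlt))
    · exact hstab .one E
        (mul_pos (h.pos_of_lt .one X E hE hlt) (h.pos_of_lt .one Y E hE (hcd.trans hlt)))
  have one_unstable : ∀ E ∈ Ioo 0 ε, E ∈ Ioo (e .one Y) (e .one X) →
      ModeNature p δ E .one .unstable := fun E hE hlt => hunst .one E
    (mul_neg_of_neg_of_pos (h.neg .one X E hE hlt.2) (h.pos_of_lt .one Y E hE hlt.1))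
  have hsub {k l : Mode} {Z W : Family} {E : ℝ} (hE : E ∈ Ioo (e k Z) (e l W)) : E ∈ Ioo 0 ε :=
    ⟨(hmem k Z).1.trans hE.1, hE.2.trans (hmem l W).2⟩
  refine ⟨⟨(hmem .two X).1, hab, hbc, hcd, (hmem .one X).2⟩, ?_, ?_, ?_, ?_,
    fun E hE => h.fixedPoints_eq hE,
    fun E hE => ⟨h.exists_isPair_stable hX hE, h.familyPoints_eq_empty X hE⟩,
    fun E hE => ⟨h.exists_isPair_unstable hY hE, h.familyPoints_eq_empty Y hE⟩,
    fun E hE => ⟨two_stable E hE, two_unstable E hE⟩,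
    fun E hE => ⟨one_stable E hE, one_unstable E hE⟩⟩
  · refine h.pitchforkOn nhdsWithin_le_nhds ?_ ?_
    · filter_upwards [Ioo_mem_nhdsLT (hmem .two X).1] with E hE
      have hE0 : E ∈ Ioo 0 ε := ⟨hE.1, hE.2.trans (hmem .two X).2⟩
      exact ⟨h.familyPoints_eq_empty X hE0 fun h' => hE.2.not_gt h'.1,
        two_stable E hE0 (Or.inl hE.2)⟩
    · filter_upwards [Ioo_mem_nhdsGT hab] with E hE
      exact ⟨h.exists_isPair_stable hX (hsub hE) ⟨hE.1, hE.2.trans (hbc.trans hcd)⟩,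
        two_unstable E (hsub hE) hE⟩
  · refine h.pitchforkOn nhdsWithin_le_nhds ?_ ?_
    · filter_upwards [Ioo_mem_nhdsLT hab] with E hE
      exact ⟨h.familyPoints_eq_empty Y (hsub hE) fun h' => hE.2.not_gt h'.1,
        two_unstable E (hsub hE) hE⟩
    · filter_upwards [Ioo_mem_nhdsGT hbc] with E hE
      exact ⟨h.exists_isPair_unstable hY (hsub hE) hE, two_stable E (hsub hE) (Or.inr hE.1)⟩
  · refine h.pitchforkOn nhdsWithin_le_nhds ?_ ?_
    · filter_upwards [Ioo_mem_nhdsGT hcd] with E hE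
      exact ⟨h.familyPoints_eq_empty Y (hsub hE) fun h' => hE.1.not_gt h'.2,
        one_unstable E (hsub hE) hE⟩
    · filter_upwards [Ioo_mem_nhdsLT hbc] with E hE
      exact ⟨h.exists_isPair_unstable hY (hsub hE) hE, one_stable E (hsub hE) (Or.inl hE.2)⟩
  · refine h.pitchforkOn nhdsWithin_le_nhds ?_ ?_
    · filter_upwards [Ioo_mem_nhdsGT (hmem .one X).2] with E hE
      have hE0 : E ∈ Ioo 0 ε := ⟨(hmem .one X).1.trans hE.1, hE.2⟩
      exact ⟨h.familyPoints_eq_empty X hE0 fun h' => hE.1.not_gt h'.2,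
        one_stable E hE0 (Or.inr hE.1)⟩
    · filter_upwards [Ioo_mem_nhdsLT hcd] with E hE
      exact ⟨h.exists_isPair_stable hX (hsub hE) ⟨(hab.trans hbc).trans hE.1, hE.2⟩,
        one_unstable E (hsub hE) hE⟩

end IsRegime

/-- Near the origin of parameter space the slope of the phase velocities is close to
`8 (A - 2C - σ C)`, and `b₀ + b₁ J` is close to `4 C`. -/
theorem exists_slope_amp_bound (p : ResCoeffs) {m : ℝ} (hC : p.C ≠ 0)
    (hm : ∀ X : Family, m < 8 * (p.A - 2 * p.C - X.sign * p.C)) :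
    ∃ r > 0, ∀ δ E T : ℝ, |δ| < r → |E| < r → |T| < r →
      (∀ X, m < p.freqSlope δ X E T) ∧ 0 < p.C * (p.b₀ δ E + p.b₁ * T) := by
  have hs (X : Family) : ∀ᶠ w : ℝ × ℝ × ℝ in 𝓝 0, m < p.freqSlope w.1 X w.2.1 w.2.2 := by
    refine ContinuousAt.eventually_lt (by fun_prop) ?_ ?_
    · unfold freqSlope a₂ b₀
      fun_prop
    · refine (hm X).trans_eq ?_
      simp [freqSlope, a₂, b₀]
      ring
  have ha : ∀ᶠ w : ℝ × ℝ × ℝ in 𝓝 0, 0 < p.C * (p.b₀ w.1 w.2.1 + p.b₁ * w.2.2) := by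
    refine ContinuousAt.eventually_lt (by fun_prop) ?_ ?_
    · unfold b₀
      fun_prop
    · have : 0 < p.C ^ 2 := sq_pos_iff.2 hC
      simp [b₀]
      linarith
  obtain ⟨r, hr, h⟩ := Metric.eventually_nhds_iff.1 ((hs .inclined).and ((hs .loop).and ha))
  refine ⟨r, hr, fun δ E T h1 h2 h3 => ?_⟩
  have := @h (δ, E, T) (by simp [Prod.norm_def, h1, h2, h3])
  refine ⟨fun X => ?_, this.2.2⟩
  cases X
  exacts [this.1, this.2.1]

theorem exists_eventually_isRegime (p : ResCoeffs) (hC : p.C ≠ 0)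
    (hI : 0 < p.A - 3 * p.C) (hL : 0 < p.A - p.C) (hl : ∀ k X, 0 < p.modeLin X k) :
    ∃ ε > 0, ∃ m, ∀ᶠ δ in 𝓝[<] 0, p.IsRegime δ ε m fun k X => p.threshold k X δ := by
  obtain ⟨m, hm0, hm⟩ : ∃ m > 0, ∀ X : Family, m < 8 * (p.A - 2 * p.C - X.sign * p.C) := by
    refine ⟨min (p.A - 3 * p.C) (p.A - p.C), lt_min hI hL, fun X => ?_⟩
    cases X <;> simp only [Family.sign]
    · linarith [min_le_left (p.A - 3 * p.C) (p.A - p.C)]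
    · linarith [min_le_right (p.A - 3 * p.C) (p.A - p.C)]
  obtain ⟨r, hr, hb⟩ := p.exists_slope_amp_bound hC hm
  obtain ⟨ε, hε, hεr, hεl⟩ : ∃ ε > 0, 2 * ε ≤ r ∧
      ∀ k X, 4 * |p.modeQuad X k| * ε ≤ p.modeLin X k := by
    have hev : ∀ᶠ ε in 𝓝[>] (0 : ℝ), ∀ k X, 4 * |p.modeQuad X k| * ε ≤ p.modeLin X k := by
      have hkX (k X) : ∀ᶠ ε in 𝓝[>] (0 : ℝ), 4 * |p.modeQuad X k| * ε ≤ p.modeLin X k := by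
        have : ContinuousAt (fun ε : ℝ => 4 * |p.modeQuad X k| * ε) 0 := by fun_prop
        exact nhdsWithin_le_nhds ((this.eventually_lt_const (by simpa using hl k X)).mono
          fun _ h => h.le)
      filter_upwards [hkX .one .inclined, hkX .one .loop, hkX .two .inclined, hkX .two .loop]
        with ε h1 h2 h3 h4 k X
      cases k <;> cases X <;> assumption
    obtain ⟨ε, h1, h2⟩ := (hev.and (Ioo_mem_nhdsGT (half_pos hr))).exists
    exact ⟨ε, h2.1, by linarith [h2.2], h1⟩
  refine ⟨ε, hε, m, ?_⟩
  have hth (k X) := eventually_sign_smallRoot (hl k X) (p.modeMix X k) (p.modeQuad X k) hε (hεl k X)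
  have hth' : ∀ᶠ δ in 𝓝[<] (0 : ℝ), ∀ k X, 0 < p.threshold k X δ ∧ p.threshold k X δ < ε ∧
      p.freq δ X (p.threshold k X δ) (k.J (p.threshold k X δ)) = 0 ∧
      ∀ E ∈ Ioo 0 ε, (E < p.threshold k X δ → p.freq δ X E (k.J E) < 0) ∧
        (p.threshold k X δ < E → 0 < p.freq δ X E (k.J E)) := by
    filter_upwards [hth .one .inclined, hth .one .loop, hth .two .inclined, hth .two .loop]
      with δ h1 h2 h3 h4 k X
    simp only [freq_mode]
    cases k <;> cases X <;> assumption
  filter_upwards [hth', Ioo_mem_nhdsLT (neg_neg_of_pos hr)] with δ h hδ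
  have hδ' : |δ| < r := abs_lt.2 ⟨hδ.1, hδ.2.trans hr⟩
  have habs {E T : ℝ} (hE : E ∈ Ioo 0 ε) (hT : T ∈ Icc 0 (2 * E)) : |E| < r ∧ |T| < r := by
    rw [abs_of_pos hE.1, abs_of_nonneg hT.1]
    constructor <;> linarith [hE.1, hE.2, hT.2]
  exact
    { pos := hm0
      slope := fun X E hE T hT => ((hb δ E T hδ' (habs hE hT).1 (habs hE hT).2).1 X).le
      amp := fun E hE J hJ =>
        have hJ' : J ∈ Icc 0 (2 * E) := ⟨hJ.1, by linarith [hJ.2, hE.1]⟩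
        (hb δ E J hδ' (habs hE hJ').1 (habs hE hJ').2).2
      mem := fun k X => ⟨(h k X).1, (h k X).2.1⟩
      zero := fun k X => (h k X).2.2.1
      neg := fun k X E hE => ((h k X).2.2.2 E hE).1
      pos_of_lt := fun k X E hE => ((h k X).2.2.2 E hE).2 }

theorem threshold_isBigO (p : ResCoeffs) {k : Mode} {X : Family} (hl : 0 < p.modeLin X k) :
    (fun δ => p.threshold k X δ - p.expansion k X δ) =O[𝓝[<] 0] fun δ => δ ^ 3 :=
  smallRoot_isBigO hl _ _ fun _ => rfl

end ResCoeffs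
end

theorem proposition6 (p : ResCoeffs)
    (hC : p.C ≠ 0) (hI : 0 < p.A - 3 * p.C) (hL : 0 < p.A - p.C)
    (h1I : 2 * (p.A - 3 * p.C) < p.B) (h1L : 2 * (p.A - p.C) < p.B)
    (h2I : 2 * (3 * p.C - p.A) < p.B) (h2L : 2 * (p.C - p.A) < p.B) :
    ∃ e1I e1L e2I e2L : ℝ → ℝ,
      ((fun δ => e1I δ - p.E1I δ) =O[𝓝[<] 0] fun δ => δ ^ 3) ∧
      ((fun δ => e1L δ - p.E1L δ) =O[𝓝[<] 0] fun δ => δ ^ 3) ∧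
      ((fun δ => e2I δ - p.E2I δ) =O[𝓝[<] 0] fun δ => δ ^ 3) ∧
      ((fun δ => e2L δ - p.E2L δ) =O[𝓝[<] 0] fun δ => δ ^ 3) ∧
      ∃ δ₀ > 0, ∃ ε > 0, ∀ δ ∈ Ioo (-δ₀) 0,
        (0 < p.C →
          FullSequence p δ ε .loop .inclined (e2L δ) (e2I δ) (e1I δ) (e1L δ)) ∧
        (p.C < 0 →
          FullSequence p δ ε .inclined .loop (e2I δ) (e2L δ) (e1L δ) (e1I δ)) := by
  have hl (k : Mode) (X : Family) : 0 < p.modeLin X k := by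
    cases k <;> cases X <;> simp only [ResCoeffs.modeLin, Family.sign] <;> linarith
  refine ⟨p.threshold .one .inclined, p.threshold .one .loop, p.threshold .two .inclined,
    p.threshold .two .loop, ?_, ?_, ?_, ?_, ?_⟩
  · rw [p.E1I_eq h1I]
    exact p.threshold_isBigO (hl _ _)
  · rw [p.E1L_eq h1L]
    exact p.threshold_isBigO (hl _ _)
  · rw [p.E2I_eq h2I]
    exact p.threshold_isBigO (hl _ _)
  · rw [p.E2L_eq h2L]
    exact p.threshold_isBigO (hl _ _)
  obtain ⟨ε, hε, m, hreg⟩ := p.exists_eventually_isRegime hC hI hL hl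
  -- The thresholds are `-δ / modeLin` to leading order, so larger slopes give smaller thresholds.
  have hord {k k' : Mode} {X X' : Family} (h : p.modeLin X k < p.modeLin X' k') :
      ∀ᶠ δ in 𝓝[<] (0 : ℝ), p.threshold k' X' δ < p.threshold k X δ :=
    eventually_smallRoot_lt (hl k X) h _ _ _ _
  have hfin : ∀ᶠ δ in 𝓝[<] (0 : ℝ),
      (0 < p.C → FullSequence p δ ε .loop .inclined (p.threshold .two .loop δ)
        (p.threshold .two .inclined δ) (p.threshold .one .inclined δ)
        (p.threshold .one .loop δ)) ∧
      (p.C < 0 → FullSequence p δ ε .inclined .loop (p.threshold .two .inclined δ)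
        (p.threshold .two .loop δ) (p.threshold .one .loop δ)
        (p.threshold .one .inclined δ)) := by
    rcases lt_or_gt_of_ne hC with hneg | hpos
    · filter_upwards [hreg,
        hord (k := .two) (k' := .two) (X := .loop) (X' := .inclined) (by
          simp only [ResCoeffs.modeLin, Family.sign]; linarith),
        hord (k := .one) (k' := .two) (X := .loop) (X' := .loop) (by
          simp only [ResCoeffs.modeLin, Family.sign]; linarith),
        hord (k := .one) (k' := .one) (X := .inclined) (X' := .loop) (by
          simp only [ResCoeffs.modeLin, Family.sign]; linarith)] with δ h h1 h2 h3
      exact ⟨fun h' => absurd h' hneg.not_gt, fun _ =>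
          h.fullSequence (by simpa [Family.sign]) (by simpa [Family.sign]) h1 h2 h3⟩
    · filter_upwards [hreg,
        hord (k := .two) (k' := .two) (X := .inclined) (X' := .loop) (by
          simp only [ResCoeffs.modeLin, Family.sign]; linarith),
        hord (k := .one) (k' := .two) (X := .inclined) (X' := .inclined) (by
          simp only [ResCoeffs.modeLin, Family.sign]; linarith),
        hord (k := .one) (k' := .one) (X := .loop) (X' := .inclined) (by
          simp only [ResCoeffs.modeLin, Family.sign]; linarith)] with δ h h1 h2 h3
      exact ⟨fun _ =>
          h.fullSequence (by simpa [Family.sign]) (by simpa [Family.sign]) h1 h2 h3,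
          fun h' => absurd h' hpos.not_gt⟩
  obtain ⟨d, hd, hsub⟩ := mem_nhdsLT_iff_exists_Ioo_subset.1 hfin
  exact ⟨-d, neg_pos.2 hd, ε, hε, fun δ hδ => hsub (by rwa [neg_neg] at hδ)⟩
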